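/- Metric spaces may have infinite distances. A metric space $(X,d)$ is \emph{convex} if for all $x\ne y$ in $X$ with $d(x,y)<\infty$ there is $z\in X\setminus\{x,y\}$ with $d(x,y)=d(x,z)+d(z,y)$. Let $\mathbf{CCMet}$ be the category of complete convex metric spaces and non-expansive maps, with its symmetric monoidal structure $X\otimes Y=X\times Y$, metrized by $d((x,y),(x',y'))=d_X(x,x')+d_Y(y,y')$. For objects $X,Y$, the internal hom $[X,Y]$ is said to exist if the functor $\mathbf{CCMet}(-\otimes X,Y):\mathbf{CCMet}^{op}\to\mathbf{Set}$ is representable. Let $\mathbb S^1$ be the circle of length $1$ with its arc-length metric. The monoidal category $\mathbf{CCMet}$ is not closed. Moreover, there is an object $X$ of $\mathbf{CCMet}$ for which $[\mathbb S^1,X]$ does not exist, obtained as follows. There are a real number $L\ge 0$ and, for every real $i\ge 0$, a closed connected smooth Riemannian manifold $X_i$ with its Riemannian distance $d_i$, an isometric embedding $\gamma_i:\mathbb S^1\to X_i$ (a closed geodesic of length $1$) and a point $p_i\in X_i$, such that (1) $\gamma_0$ is not homotopic to a constant map, $p_0\notin\gamma_0(\mathbb S^1)$, and $d_0(p_0,\gamma_0(t))<L$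 for all $t\in\mathbb S^1$; (2) for all $\varepsilon>0$ and $t\in\mathbb S^1$ there is exactly one minimizing geodesic (isometric map) $[0,L+\varepsilon]\to X_\varepsilon$ from $p_\varepsilon$ to $\gamma_\varepsilon(t)$; (3) the metric space $X$ obtained by gluing all the $X_i$, $i\ge 0$, along the identifications $\gamma_i(t)\sim\gamma_k(t)$ $(t\in\mathbb S^1)$ and $p_i\sim p_k$ (the distance being the infimum of the sums $\sum_{s=0}^n d(a_s,b_s)$ over chains with $b_s\sim a_{s+1}$, where $d$ is $d_i$ on $X_i$ and infinite between different $X_i$, and points at distance zero being identified) is complete and convex; (4) let $\iota:\mathbb S^1\to X$ be the common image of the $\gamma_i$ and $\mathrm{ct}:\mathbb S^1\to X$ the constant map at the common image of the $p_i$. Then $\iota$ is an isometric embedding and, in the space of non-expansive maps $\mathbb S^1\to X$ with the supremum distance, the infimum of the lengths of the curves from $\iota$ to $\mathrm{ct}$ equals $L$, but no curve from $\iota$ to $\mathrm{ct}$ has length $L$; (5) the internal hom $[\mathbb S^1,X]$ in $\mathbf{CCMet}$ does not exist. -/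

import Mathlib

open CategoryTheory MonoidalCategory
open scoped ENNReal NNReal Manifold ContDiff Bundle

noncomputable section

universe u v

/-! Metric spaces with possibly infinite distances are Mathlib's `EMetricSpace`s. -/

/-- Convexity: any two distinct points at finite distance have a third point metrically between
them. -/
def IsConvexMetric (X : Type u) [EMetricSpace X] : Prop :=
  ∀ x y : X, x ≠ y → edist x y ≠ ⊤ →
    ∃ z : X, z ≠ x ∧ z ≠ y ∧ edist x y = edist x z + edist z y

/-! ### Non-expansive maps and the supremum metric -/

/-- Non-expansive (`1`-Lipschitz) maps. -/
@[ext]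
structure NonExp (X : Type u) (Y : Type v) [EMetricSpace X] [EMetricSpace Y] where
  toFun : X → Y
  lipschitz : LipschitzWith 1 toFun

namespace NonExp

variable {X : Type u} {Y : Type v} [EMetricSpace X] [EMetricSpace Y]

instance : FunLike (NonExp X Y) X Y where
  coe := toFun
  coe_injective _ _ h := NonExp.ext h

theorem edist_le (f : NonExp X Y) (x y : X) : edist (f x) (f y) ≤ edist x y := by
  have h := f.lipschitz x y
  rwa [ENNReal.coe_one, one_mul] at h

/-- The space of non-expansive maps with the supremum distance. For complete `X` and `Y` this is
the internal hom `[X, Y]` of the category of complete metric spaces. -/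
instance : EMetricSpace (NonExp X Y) where
  edist f g := ⨆ x, edist (f x) (g x)
  edist_self f := by simp
  edist_comm f g := by simp only [edist_comm]
  edist_triangle f g h := iSup_le fun x =>
    (edist_triangle (f x) (g x) (h x)).trans
      (add_le_add (le_iSup (fun x => edist (f x) (g x)) x)
        (le_iSup (fun x => edist (g x) (h x)) x))
  eq_of_edist_eq_zero {f g} h := by
    apply DFunLike.ext
    intro x
    apply eq_of_edist_eq_zero
    exact le_antisymm ((le_iSup (fun x => edist (f x) (g x)) x).trans h.le) bot_le

end NonExp

/-! ### The category of complete convex metric spaces -/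

/-- The objects of `CCMet`: complete convex metric spaces. -/
structure CCMet : Type (u + 1) where
  carrier : Type u
  [metric : EMetricSpace carrier]
  [complete : CompleteSpace carrier]
  convex : IsConvexMetric carrier

namespace CCMet

instance : CoeSort CCMet.{u} (Type u) := ⟨carrier⟩

attribute [instance] metric complete

/-- Morphisms of `CCMet` are the non-expansive maps. -/
instance : Category CCMet.{u} where
  Hom X Y := NonExp X Y
  id X := ⟨id, LipschitzWith.id⟩
  comp f g := ⟨g.toFun ∘ f.toFun, by simpa using g.lipschitz.comp f.lipschitz⟩

theorem hom_ext {X Y : CCMet.{u}} {f g : X ⟶ Y} (h : ∀ x : X, f.toFun x = g.toFun x) : f = g :=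
  NonExp.ext (funext h)

/-- A morphism of `CCMet` from a function that does not increase distances. -/
def mkHom {X Y : CCMet.{u}} (f : X → Y) (h : ∀ x y, edist (f x) (f y) ≤ edist x y) : X ⟶ Y :=
  NonExp.mk f (by intro x y; simpa using h x y)

/-- An isomorphism of `CCMet` from a distance preserving bijection. -/
def mkIso {X Y : CCMet.{u}} (f : X → Y) (g : Y → X) (hgf : ∀ x, g (f x) = x)
    (hfg : ∀ y, f (g y) = y) (h : ∀ x y, edist (f x) (f y) = edist x y) : X ≅ Y where
  hom := mkHom f fun x y => (h x y).le
  inv := mkHom g fun x y => by rw [← h (g x) (g y), hfg, hfg]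
  hom_inv_id := hom_ext hgf
  inv_hom_id := hom_ext hfg

end CCMet

/-- The distance of `WithLp 1 (X × Y)` is the `ℓ¹` distance. -/
theorem edist_l1 {X : Type u} {Y : Type v} [EMetricSpace X] [EMetricSpace Y]
    (a b : WithLp 1 (X × Y)) : edist a b = edist a.fst b.fst + edist a.snd b.snd := by
  rw [WithLp.prod_edist_eq_add (by simp)]
  simp

theorem IsConvexMetric.l1 {X : Type u} {Y : Type v} [EMetricSpace X] [EMetricSpace Y]
    (hX : IsConvexMetric X) (hY : IsConvexMetric Y) : IsConvexMetric (WithLp 1 (X × Y)) := by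
  rintro ⟨x, y⟩ ⟨x', y'⟩ hne hfin
  rw [edist_l1] at hfin
  simp only [ne_eq, ENNReal.add_eq_top, not_or] at hfin
  by_cases hx : x = x'
  · subst hx
    have hy : y ≠ y' := by rintro rfl; exact hne rfl
    obtain ⟨z, hz, hz', h⟩ := hY y y' hy hfin.2
    refine ⟨WithLp.toLp 1 (x, z), ?_, ?_, ?_⟩
    · intro h0; exact hz (congrArg (fun w : WithLp 1 (X × Y) => w.snd) h0)
    · intro h0; exact hz' (congrArg (fun w : WithLp 1 (X × Y) => w.snd) h0)
    · simp only [edist_l1]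
      simpa using h
  · obtain ⟨z, hz, hz', h⟩ := hX x x' hx hfin.1
    refine ⟨WithLp.toLp 1 (z, y), ?_, ?_, ?_⟩
    · intro h0; exact hz (congrArg (fun w : WithLp 1 (X × Y) => w.fst) h0)
    · intro h0; exact hz' (congrArg (fun w : WithLp 1 (X × Y) => w.fst) h0)
    · simp only [edist_l1]
      change edist x x' + edist y y' = (edist x z + edist y y) + (edist z x' + edist y y')
      rw [h, edist_self, add_zero, add_assoc]

namespace CCMet

/-- The tensor product: the Cartesian product with the `ℓ¹` metric. -/
def tensor (X Y : CCMet.{u}) : CCMet.{u} where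
  carrier := WithLp 1 (X × Y)
  convex := X.convex.l1 Y.convex

/-- The monoidal unit: the one-point space. -/
def unit : CCMet.{u} where
  carrier := PUnit.{u + 1}
  convex := fun x y h => (h (Subsingleton.elim x y)).elim

def tensorMap {X Y X' Y' : CCMet.{u}} (f : X ⟶ Y) (g : X' ⟶ Y') :
    tensor X X' ⟶ tensor Y Y' :=
  mkHom (X := tensor X X') (Y := tensor Y Y')
    (fun w : WithLp 1 (X × X') => WithLp.toLp 1 (f.toFun w.fst, g.toFun w.snd)) (by
      intro a b
      refine (edist_l1 _ _).le.trans (le_trans ?_ (edist_l1 _ _).ge)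
      exact add_le_add (NonExp.edist_le f _ _) (NonExp.edist_le g _ _))

def assoc (X Y Z : CCMet.{u}) : tensor (tensor X Y) Z ≅ tensor X (tensor Y Z) :=
  mkIso (X := tensor (tensor X Y) Z) (Y := tensor X (tensor Y Z))
    (fun w : WithLp 1 (WithLp 1 (X × Y) × Z) =>
      WithLp.toLp 1 (w.fst.fst, WithLp.toLp 1 (w.fst.snd, w.snd)))
    (fun w : WithLp 1 (X × WithLp 1 (Y × Z)) =>
      WithLp.toLp 1 (WithLp.toLp 1 (w.fst, w.snd.fst), w.snd.snd))
    (fun _ => rfl) (fun _ => rfl) (by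
      intro a b
      refine (edist_l1 _ _).trans ?_
      refine Eq.trans ?_ (edist_l1 _ _).symm
      refine (congrArg (_ + ·) (edist_l1 _ _)).trans ?_
      refine Eq.trans ?_ (congrArg (· + _) (edist_l1 _ _)).symm
      exact (add_assoc _ _ _).symm)

def leftUnit (X : CCMet.{u}) : tensor unit X ≅ X :=
  mkIso (X := tensor unit X) (Y := X)
    (fun w : WithLp 1 (PUnit.{u + 1} × X) => w.snd)
    (fun x : X => WithLp.toLp 1 (PUnit.unit, x))
    (fun _ => rfl) (fun _ => rfl) (by
      intro a b
      refine Eq.trans ?_ (edist_l1 _ _).symm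
      exact (zero_add _).symm.trans (congrArg (· + _) (edist_self _).symm))

def rightUnit (X : CCMet.{u}) : tensor X unit ≅ X :=
  mkIso (X := tensor X unit) (Y := X)
    (fun w : WithLp 1 (X × PUnit.{u + 1}) => w.fst)
    (fun x : X => WithLp.toLp 1 (x, PUnit.unit))
    (fun _ => rfl) (fun _ => rfl) (by
      intro a b
      refine Eq.trans ?_ (edist_l1 _ _).symm
      exact (add_zero _).symm.trans (congrArg (_ + ·) (edist_self _).symm))

def swap (X Y : CCMet.{u}) : tensor X Y ≅ tensor Y X :=
  mkIso (X := tensor X Y) (Y := tensor Y X)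
    (fun w : WithLp 1 (X × Y) => WithLp.toLp 1 (w.snd, w.fst))
    (fun w : WithLp 1 (Y × X) => WithLp.toLp 1 (w.snd, w.fst))
    (fun _ => rfl) (fun _ => rfl) (by
      intro a b
      refine (edist_l1 _ _).trans ?_
      exact Eq.trans (add_comm _ _) (edist_l1 _ _).symm)

instance : MonoidalCategoryStruct CCMet.{u} where
  tensorObj := tensor
  tensorUnit := unit
  tensorHom f g := tensorMap f g
  whiskerLeft X _ _ f := tensorMap (𝟙 X) f
  whiskerRight f X := tensorMap f (𝟙 X)
  associator := assoc
  leftUnitor := leftUnit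
  rightUnitor := rightUnit

instance : MonoidalCategory CCMet.{u} :=
  MonoidalCategory.ofTensorHom
    (id_tensorHom_id := fun _ _ => rfl)
    (id_tensorHom := fun _ _ _ _ => rfl)
    (tensorHom_id := fun _ _ => rfl)
    (tensorHom_comp_tensorHom := fun _ _ _ _ => rfl)
    (associator_naturality := fun _ _ _ => rfl)
    (leftUnitor_naturality := fun _ => rfl)
    (rightUnitor_naturality := fun _ => rfl)
    (pentagon := fun _ _ _ _ => rfl)
    (triangle := fun _ _ => rfl)

instance : SymmetricCategory CCMet.{u} where
  braiding := swap
  braiding_naturality_right _ _ _ _ := rfl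
  braiding_naturality_left _ _ := rfl
  hexagon_forward _ _ _ := rfl
  hexagon_reverse _ _ _ := rfl
  symmetry _ _ := rfl

/-- The object `[X, Y]` exists in `CCMet`: the functor `CCMet(- ⊗ X, Y) : CCMetᵒᵖ ⥤ Set` is
representable. -/
def InternalHomExists (X Y : CCMet.{u}) : Prop :=
  ((tensorRight X).op ⋙ yoneda.obj Y).IsRepresentable

end CCMet

/-! ### The circle of length one -/

/-- In a normed group, halving `y - x` produces a point metrically between `x` and `y`. -/
theorem exists_between_of_half {G : Type u} [NormedAddCommGroup G] {x y v : G} (hne : x ≠ y)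
    (hv : v + v = y - x) (hn : ‖y - x‖ = ‖v‖ + ‖v‖) :
    ∃ z : G, z ≠ x ∧ z ≠ y ∧ edist x y = edist x z + edist z y := by
  have h0 : v ≠ 0 := by
    rintro rfl
    rw [add_zero] at hv
    exact hne (sub_eq_zero.1 hv.symm).symm
  have h1 : y - (x + v) = v := by rw [← sub_sub, ← hv, add_sub_cancel_right]
  refine ⟨x + v, ?_, ?_, ?_⟩
  · intro h
    exact h0 (by simpa using h)
  · intro h
    rw [h, sub_self] at h1
    exact h0 h1.symm
  · have hxz : dist x (x + v) = ‖v‖ := by rw [dist_comm, dist_eq_norm, add_sub_cancel_left]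
    have hzy : dist (x + v) y = ‖v‖ := by rw [dist_comm, dist_eq_norm, h1]
    rw [edist_dist, edist_dist, edist_dist, ← ENNReal.ofReal_add dist_nonneg dist_nonneg,
      hxz, hzy, dist_comm, dist_eq_norm, hn]

/-- `UnitAddCircle = ℝ / ℤ` carries the arc-length distance of a circle of length one. -/
theorem isConvexMetric_unitAddCircle : IsConvexMetric UnitAddCircle := by
  intro x y hne _
  obtain ⟨s, hs⟩ := QuotientAddGroup.mk_surjective (y - x)
  have h0 : ((round s : ℝ) : UnitAddCircle) = 0 :=
    (AddCircle.coe_eq_zero_iff (1 : ℝ)).2 ⟨round s, by simp⟩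
  have ht : ((s - round s : ℝ) : UnitAddCircle) = y - x := by
    rw [AddCircle.coe_sub, h0, sub_zero]
    exact hs
  generalize hr : s - round s = t at ht
  have htn : |t| ≤ 1 / 2 := hr ▸ abs_sub_round s
  have hn : ∀ r : ℝ, |r| ≤ 1 / 2 → ‖(r : UnitAddCircle)‖ = |r| := fun r hr =>
    (AddCircle.norm_coe_eq_abs_iff (1 : ℝ) one_ne_zero).2 (by rwa [abs_one])
  have hhalf : ‖((t / 2 : ℝ) : UnitAddCircle)‖ = |t| / 2 := by
    rw [hn _ (by rw [abs_div, abs_two]; linarith), abs_div, abs_two]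
  refine exists_between_of_half hne (v := ((t / 2 : ℝ) : UnitAddCircle)) ?_ ?_
  · rw [← ht, ← AddCircle.coe_add, add_halves]
  · rw [← ht, hn t htn, hhalf, add_halves]

/-- The circle of length one, as an object of `CCMet`. -/
def circleOne : CCMet.{0} where
  carrier := UnitAddCircle
  convex := isConvexMetric_unitAddCircle

/-! ### Lengths of curves -/

/-- The set of lengths of the curves `φ : [a, b] → X` from `x` to `y`. -/
def curveLengths {X : Type u} [EMetricSpace X] (x y : X) : Set ℝ≥0∞ :=
  {l | ∃ (a b : ℝ) (φ : ℝ → X), a ≤ b ∧ ContinuousOn φ (Set.Icc a b) ∧ φ a = x ∧ φ b = y ∧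
    eVariationOn φ (Set.Icc a b) = l}

/-- The length distance (intrinsic metric) attached to a metric: the infimum of the lengths of
the curves from `x` to `y`. -/
def lengthEDist {X : Type u} [EMetricSpace X] (x y : X) : ℝ≥0∞ := sInf (curveLengths x y)

/-! ### Gluing -/

section Chains

variable {α : Type u} (r : α → α → Prop) (d : α → α → ℝ≥0∞)

/-- `ChainSum r d x y s`: there are `(p₀, q₀), …, (pₙ, qₙ)` with `p₀ = x`, `qₙ = y`,
`qₖ ∼ pₖ₊₁` and `d p₀ q₀ + … + d pₙ qₙ = s`. -/
inductive ChainSum : α → α → ℝ≥0∞ → Prop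
  | single (x y : α) : ChainSum x y (d x y)
  | cons (x q p y : α) (s : ℝ≥0∞) : r q p → ChainSum p y s → ChainSum x y (d x q + s)

/-- The quotient semi-metric: the infimum of the sums over all chains. -/
def chainDist (x y : α) : ℝ≥0∞ := sInf {s | ChainSum r d x y s}

variable {r d}

theorem ChainSum.append {x y y' z : α} {s t : ℝ≥0∞} (h : ChainSum r d x y s) (hr : r y y')
    (h' : ChainSum r d y' z t) : ChainSum r d x z (s + t) := by
  induction h with
  | single x y => exact .cons x y y' z t hr h'
  | cons x q p y s hqp _ ih =>
    rw [add_assoc]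
    exact .cons x q p z _ hqp (ih hr)

theorem ChainSum.symm (hr : ∀ a b, r a b → r b a) (hd : ∀ a b, d a b = d b a) {x y : α}
    {s : ℝ≥0∞} (h : ChainSum r d x y s) : ChainSum r d y x s := by
  induction h with
  | single x y => rw [hd]; exact .single y x
  | cons x q p y s hqp _ ih =>
    rw [add_comm, hd]
    exact ih.append (hr _ _ hqp) (.single q x)

theorem chainDist_self (hd : ∀ a, d a a = 0) (x : α) : chainDist r d x x = 0 :=
  le_antisymm (sInf_le (by
    simpa only [Set.mem_ofPred_eq, hd] using ChainSum.single (r := r) (d := d) x x))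
    bot_le

theorem chainDist_comm (hr : ∀ a b, r a b → r b a) (hd : ∀ a b, d a b = d b a) (x y : α) :
    chainDist r d x y = chainDist r d y x :=
  congrArg sInf (Set.ext fun _ => ⟨fun h => h.symm hr hd, fun h => h.symm hr hd⟩)

theorem chainDist_triangle (hr : ∀ a, r a a) (x y z : α) :
    chainDist r d x z ≤ chainDist r d x y + chainDist r d y z := by
  unfold chainDist
  rw [ENNReal.sInf_add]
  refine le_iInf₂ fun s hs => ?_
  rw [ENNReal.add_sInf]
  exact le_iInf₂ fun t ht => sInf_le (ChainSum.append hs (hr y) ht)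

end Chains

section Glue

variable {ι : Type u} {Y : Type v} {X : ι → Type u} [∀ i, EMetricSpace (X i)]

/-- The distance of the disjoint union: infinite between points of different summands. -/
def sigmaEDist (a b : Σ i, X i) : ℝ≥0∞ := ⨅ h : a.1 = b.1, edist (h ▸ a.2) b.2

theorem sigmaEDist_self (a : Σ i, X i) : sigmaEDist a a = 0 := by simp [sigmaEDist]

theorem sigmaEDist_comm (a b : Σ i, X i) : sigmaEDist a b = sigmaEDist b a := by
  obtain ⟨i, x⟩ := a
  obtain ⟨k, y⟩ := b
  by_cases h : i = k
  · subst h; simp [sigmaEDist, edist_comm]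
  · simp [sigmaEDist, h, Ne.symm h]

/-- The equivalence relation on the disjoint union generated by `j i y ∼ j k y`. -/
def glueRel (j : ∀ i, Y → X i) : (Σ i, X i) → (Σ i, X i) → Prop :=
  Relation.EqvGen fun a b => ∃ (y : Y) (i k : ι), a = ⟨i, j i y⟩ ∧ b = ⟨k, j k y⟩

/-- A copy of the disjoint union, for the quotient semi-metric. -/
structure PreGlue (j : ∀ i, Y → X i) where
  point : Σ i, X i

instance (j : ∀ i, Y → X i) : PseudoEMetricSpace (PreGlue j) where
  edist a b := chainDist (glueRel j) sigmaEDist a.point b.point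
  edist_self a := chainDist_self sigmaEDist_self a.point
  edist_comm a b := chainDist_comm (fun _ _ h => h.symm) sigmaEDist_comm a.point b.point
  edist_triangle a b c :=
    chainDist_triangle (fun p => Relation.EqvGen.refl p) a.point b.point c.point

/-- The space obtained by gluing the `X i` along the maps `j i : Y → X i`: points at distance zero
in the quotient semi-metric (in particular, equivalent points) are identified. -/
abbrev Glue (j : ∀ i, Y → X i) : Type u := SeparationQuotient (PreGlue j)

/-- The canonical map of `X i` into the glued space. -/
def Glue.incl (j : ∀ i, Y → X i) (i : ι) (x : X i) : Glue j := SeparationQuotient.mk ⟨⟨i, x⟩⟩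

end Glue

/-! ### Closed Riemannian manifolds -/

/-- A closed connected (that is: compact, without boundary) smooth Riemannian manifold, with its
Riemannian distance. -/
structure ClosedRiemannianManifold where
  model : Type
  [normed : NormedAddCommGroup model]
  [normedSpace : NormedSpace ℝ model]
  [finiteDim : FiniteDimensional ℝ model]
  chart : Type
  [chartTop : TopologicalSpace chart]
  corners : ModelWithCorners ℝ model chart
  carrier : Type
  [metric : EMetricSpace carrier]
  [charted : ChartedSpace chart carrier]
  [smooth : IsManifold corners ∞ carrier]
  [boundaryless : BoundarylessManifold corners carrier]
  [riemannian : Bundle.RiemannianBundle (fun x : carrier => TangentSpace corners x)]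
  [smoothMetric : IsContMDiffRiemannianBundle corners ∞ model
    (fun x : carrier => TangentSpace corners x)]
  [distance : IsRiemannianManifold corners carrier]
  [compact : CompactSpace carrier]
  [connected : ConnectedSpace carrier]

instance : CoeSort ClosedRiemannianManifold Type := ⟨ClosedRiemannianManifold.carrier⟩

attribute [instance] ClosedRiemannianManifold.metric

/-- `c : [0, l] → X` is a minimizing geodesic from `x` to `y`. -/
def IsMinimizingGeodesic {X : Type u} [EMetricSpace X] {l : ℝ≥0} (x y : X)
    (c : Set.Icc (0 : ℝ) l → X) : Prop :=
  Isometry c ∧ c ⟨0, le_rfl, l.2⟩ = x ∧ c ⟨l, l.2, le_rfl⟩ = y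

end

noncomputable section

universe u v

section Pullback
open Bundle Bornology Topology

variable {E : Type*} [NormedAddCommGroup E] [NormedSpace ℝ E]
  {H : Type*} [TopologicalSpace H] {I : ModelWithCorners ℝ E H}
  {M : Type*} [TopologicalSpace M] [ChartedSpace H M]
  {V : Type*} [NormedAddCommGroup V] [InnerProductSpace ℝ V]

/-- The bilinear form on the tangent space induced by a map to an inner product space. -/
def pullbackInner (I : ModelWithCorners ℝ E H) (Φ : M → V) (x : M) :
    TangentSpace I x →L[ℝ] TangentSpace I x →L[ℝ] ℝ :=
  (ContinuousLinearMap.precomp ℝ (mvfderiv I Φ x)) ∘L (innerSL ℝ) ∘L (mvfderiv I Φ x)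

theorem pullbackInner_apply (Φ : M → V) (x : M) (v w : TangentSpace I x) :
    pullbackInner I Φ x v w = inner ℝ (mvfderiv I Φ x v) (mvfderiv I Φ x w) := rfl

set_option synthInstance.maxHeartbeats 200000 in
set_option maxHeartbeats 1000000 in
theorem contMDiff_pullbackInner [IsManifold I ∞ M] {Φ : M → V} (hΦ : ContMDiff I 𝓘(ℝ, V) ∞ Φ) :
    ContMDiff I (I.prod 𝓘(ℝ, E →L[ℝ] E →L[ℝ] ℝ)) ∞
      (fun x ↦ TotalSpace.mk' (E →L[ℝ] E →L[ℝ] ℝ)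
        (E := fun x : M => TangentSpace I x →L[ℝ] TangentSpace I x →L[ℝ] ℝ)
        x (pullbackInner I Φ x)) := by
  intro x
  rw [contMDiffAt_hom_bundle]
  refine ⟨contMDiffAt_id, ?_⟩
  have h1 : ContMDiffAt I 𝓘(ℝ, E →L[ℝ] V) ∞
      (inTangentCoordinates I 𝓘(ℝ, V) id Φ (mfderiv I 𝓘(ℝ, V) Φ) x) x :=
    (hΦ x).mfderiv_const (m := ∞) (by simp)
  let B : (E →L[ℝ] V) → (E →L[ℝ] E →L[ℝ] ℝ) := fun L =>
    (ContinuousLinearMap.compL ℝ E V ℝ).flip L ∘L (innerSL ℝ) ∘L L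
  have hB : ContDiff ℝ ∞ B := by
    have h2 : ContDiff ℝ ∞ fun L : E →L[ℝ] V => (ContinuousLinearMap.compL ℝ E V ℝ).flip L := by
      fun_prop
    exact h2.clm_comp (contDiff_const.clm_comp contDiff_id)
  refine (hB.contMDiff.contMDiffAt.comp x h1).congr_of_eventuallyEq ?_
  have hx : ∀ᶠ y in 𝓝 x, y ∈ (trivializationAt E (TangentSpace I) x).baseSet :=
    (trivializationAt E (TangentSpace I) x).open_baseSet.mem_nhds
      (FiberBundle.mem_baseSet_trivializationAt' x)
  filter_upwards [hx] with y hy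
  ext v w
  rw [inCoordinates_apply_eq₂ hy hy (Set.mem_univ _)]
  simp only [B, Function.comp_apply, pullbackInner_apply, inTangentCoordinates]
  have key : ∀ u, ContinuousLinearMap.inCoordinates E (TangentSpace I) V (TangentSpace 𝓘(ℝ, V))
      x y (Φ x) (Φ y) (mfderiv I 𝓘(ℝ, V) Φ y) u =
      mvfderiv I Φ y ((trivializationAt E (TangentSpace I) x).symm y u) := by
    intro u
    simp only [ContinuousLinearMap.inCoordinates, ContinuousLinearMap.comp_apply]
    rw [TangentBundle.continuousLinearMapAt_model_space]
    rw [Trivialization.symmL_apply _ hy]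
    with_unfolding_all rfl
  simp only [Bundle.Trivial.fiberBundle_trivializationAt', Bundle.Trivial.linearMapAt_trivialization, LinearMap.id_coe, id_eq]
  rw [← key, ← key]
  with_unfolding_all rfl

end Pullback

section Pullback
open Bundle Bornology Topology

variable {E : Type} [NormedAddCommGroup E] [NormedSpace ℝ E]
  {H : Type} [TopologicalSpace H] {I : ModelWithCorners ℝ E H}
  {M : Type} [TopologicalSpace M] [ChartedSpace H M]
  {V : Type} [NormedAddCommGroup V] [InnerProductSpace ℝ V]

theorem isVonNBounded_of_injective [FiniteDimensional ℝ E] (L : E →L[ℝ] V)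
    (hL : Function.Injective L) : IsVonNBounded ℝ {v : E | inner ℝ (L v) (L v) < 1} := by
  obtain ⟨K, -, hK⟩ := (L : E →ₗ[ℝ] V).exists_antilipschitzWith (LinearMap.ker_eq_bot.2 hL)
  refine (NormedSpace.isVonNBounded_ball ℝ E (K + 1)).subset fun v hv => ?_
  have h1 : ‖L v‖ < 1 := by
    have : ‖L v‖ ^ 2 < 1 := by rw [← real_inner_self_eq_norm_sq]; exact hv
    nlinarith [norm_nonneg (L v)]
  have h2 : ‖v‖ ≤ K * ‖L v‖ := by simpa using hK.le_mul_dist v 0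
  rw [Metric.mem_ball, dist_zero_right]
  nlinarith [norm_nonneg (L v), K.2]

/-- The Riemannian metric induced by an immersion into an inner product space. -/
def pullbackMetric [FiniteDimensional ℝ E] [IsManifold I ∞ M] {Φ : M → V}
    (hΦ : ContMDiff I 𝓘(ℝ, V) ∞ Φ) (hinj : ∀ x, Function.Injective (mvfderiv I Φ x)) :
    ContMDiffRiemannianMetric I ∞ E (fun x : M => TangentSpace I x) where
  inner x := pullbackInner I Φ x
  symm x v w := real_inner_comm _ _
  pos x v hv := by
    rw [pullbackInner_apply]
    exact real_inner_self_pos.2 fun h => hv (hinj x (by rw [h, map_zero]))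
  isVonNBounded x := isVonNBounded_of_injective (E := E) (mvfderiv I Φ x) (hinj x)
  contMDiff := contMDiff_pullbackInner hΦ

/-- The inner products on the tangent spaces induced by an immersion. -/
@[reducible] def pullbackBundle [FiniteDimensional ℝ E] [IsManifold I ∞ M] {Φ : M → V}
    (hΦ : ContMDiff I 𝓘(ℝ, V) ∞ Φ) (hinj : ∀ x, Function.Injective (mvfderiv I Φ x)) :
    RiemannianBundle (fun x : M => TangentSpace I x) :=
  ⟨(pullbackMetric hΦ hinj).toRiemannianMetric⟩

theorem pullbackBundle_contMDiff [FiniteDimensional ℝ E] [IsManifold I ∞ M] {Φ : M → V}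
    (hΦ : ContMDiff I 𝓘(ℝ, V) ∞ Φ) (hinj : ∀ x, Function.Injective (mvfderiv I Φ x)) :
    letI := pullbackBundle hΦ hinj
    IsContMDiffRiemannianBundle I ∞ E (fun x : M => TangentSpace I x) :=
  letI := pullbackBundle hΦ hinj
  ⟨pullbackInner I Φ, contMDiff_pullbackInner hΦ, fun _ _ _ => rfl⟩

theorem pullbackBundle_continuous [FiniteDimensional ℝ E] [IsManifold I ∞ M] {Φ : M → V}
    (hΦ : ContMDiff I 𝓘(ℝ, V) ∞ Φ) (hinj : ∀ x, Function.Injective (mvfderiv I Φ x)) :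
    letI := pullbackBundle hΦ hinj
    IsContinuousRiemannianBundle E (fun x : M => TangentSpace I x) :=
  letI := pullbackBundle hΦ hinj
  ⟨pullbackInner I Φ, (contMDiff_pullbackInner hΦ).continuous, fun _ _ _ => rfl⟩

/-- The distance induced by an immersion. -/
@[reducible] def pullbackEMetric [FiniteDimensional ℝ E] [IsManifold I ∞ M] [T3Space M] {Φ : M → V}
    (hΦ : ContMDiff I 𝓘(ℝ, V) ∞ Φ) (hinj : ∀ x, Function.Injective (mvfderiv I Φ x)) :
    EMetricSpace M :=
  letI := pullbackBundle hΦ hinj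
  haveI := pullbackBundle_continuous hΦ hinj
  EMetricSpace.ofRiemannianMetric I M

/-- The closed Riemannian manifold given by an immersion of a compact manifold. -/
def ClosedRiemannianManifold.ofImmersion [FiniteDimensional ℝ E] [IsManifold I ∞ M]
    [BoundarylessManifold I M] [T3Space M] [CompactSpace M] [ConnectedSpace M] {Φ : M → V}
    (hΦ : ContMDiff I 𝓘(ℝ, V) ∞ Φ) (hinj : ∀ x, Function.Injective (mvfderiv I Φ x)) :
    ClosedRiemannianManifold :=
  letI := pullbackBundle hΦ hinj
  { model := E
    chart := H
    corners := I
    carrier := M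
    metric := pullbackEMetric hΦ hinj
    charted := ‹ChartedSpace H M›
    smooth := ‹IsManifold I ∞ M›
    boundaryless := ‹BoundarylessManifold I M›
    riemannian := pullbackBundle hΦ hinj
    smoothMetric := pullbackBundle_contMDiff hΦ hinj
    distance := letI := pullbackEMetric hΦ hinj; ⟨fun _ _ => rfl⟩
    compact := ‹CompactSpace M›
    connected := ‹ConnectedSpace M› }

theorem enorm_pullbackMetric [FiniteDimensional ℝ E] [IsManifold I ∞ M] {Φ : M → V}
    (hΦ : ContMDiff I 𝓘(ℝ, V) ∞ Φ) (hinj : ∀ x, Function.Injective (mvfderiv I Φ x))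
    (x : M) (v : TangentSpace I x) :
    letI := pullbackBundle hΦ hinj
    ‖v‖ₑ = ‖mvfderiv I Φ x v‖ₑ := by
  let _ := pullbackBundle hΦ hinj
  have : ‖v‖ = ‖mvfderiv I Φ x v‖ := by
    rw [norm_eq_sqrt_real_inner (mvfderiv I Φ x v), norm_eq_sqrt_real_inner v]
    rfl
  rw [← ofReal_norm, ← ofReal_norm, this]

/-- The length of a path for the induced metric is the length of its image. -/
theorem pathELength_pullbackMetric [FiniteDimensional ℝ E] [IsManifold I ∞ M] {Φ : M → V}
    (hΦ : ContMDiff I 𝓘(ℝ, V) ∞ Φ) (hinj : ∀ x, Function.Injective (mvfderiv I Φ x))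
    {c : ℝ → M} (hc : ContMDiffOn 𝓘(ℝ) I 1 c (Set.Icc 0 1)) :
    letI := pullbackBundle hΦ hinj
    Manifold.pathELength I c 0 1 = ∫⁻ t in Set.Icc (0 : ℝ) 1,
      ‖derivWithin (Φ ∘ c) (Set.Icc 0 1) t‖ₑ := by
  let _ := pullbackBundle hΦ hinj
  rw [Manifold.pathELength_eq_lintegral_mfderivWithin_Icc]
  refine MeasureTheory.setLIntegral_congr_fun measurableSet_Icc fun t ht => ?_
  have h1 : mfderivWithin 𝓘(ℝ) 𝓘(ℝ, V) (Φ ∘ c) (Set.Icc 0 1) t =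
      (mfderiv I 𝓘(ℝ, V) Φ (c t)) ∘L (mfderivWithin 𝓘(ℝ) I c (Set.Icc 0 1) t) := by
    apply mfderiv_comp_mfderivWithin
    · exact (hΦ (c t)).mdifferentiableAt (by simp)
    · exact hc.mdifferentiableOn one_ne_zero t ht
    · rw [uniqueMDiffWithinAt_iff_uniqueDiffWithinAt]
      exact uniqueDiffOn_Icc zero_lt_one t ht
  have h2 := congr($h1 (1 : ℝ))
  rw [enorm_pullbackMetric hΦ hinj]
  congr 1
  rw [← fderivWithin_derivWithin, ← mfderivWithin_eq_fderivWithin]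
  exact h2.symm

end Pullback

section PullbackDistance
open Topology Filter

variable {E : Type} [NormedAddCommGroup E] [NormedSpace ℝ E]
  {H : Type} [TopologicalSpace H] {I : ModelWithCorners ℝ E H}
  {M : Type} [TopologicalSpace M] [ChartedSpace H M]
  {V : Type} [NormedAddCommGroup V] [InnerProductSpace ℝ V]

/-- A distance that is infinitesimally bounded by the distance of the images under `Φ` is bounded
by the length of the image of a path. -/
theorem le_integral_norm_deriv_of_local_bound {Φ : M → V} {D : M → M → ℝ}
    (hD0 : ∀ x, D x x = 0) (hDc : ∀ x y, D x y = D y x)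
    (hDt : ∀ x y z, D x z ≤ D x y + D y z)
    (hloc : ∀ x, ∀ K : ℝ, 1 < K → ∀ᶠ y in 𝓝 x, D x y ≤ K * ‖Φ y - Φ x‖)
    {c : ℝ → M} (hc : ContinuousOn c (Set.Icc 0 1))
    (hu : ContDiffOn ℝ 1 (Φ ∘ c) (Set.Icc 0 1)) :
    D (c 0) (c 1) ≤ ∫ t in Set.Icc (0 : ℝ) 1, ‖derivWithin (Φ ∘ c) (Set.Icc 0 1) t‖ := by
  set g : ℝ → ℝ := fun t => ‖derivWithin (Φ ∘ c) (Set.Icc 0 1) t‖ with hg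
  have hgc : ContinuousOn g (Set.Icc 0 1) :=
    (hu.continuousOn_derivWithin (uniqueDiffOn_Icc zero_lt_one) le_rfl).norm
  set G : ℝ → ℝ := Set.IccExtend (zero_le_one (α := ℝ)) ((Set.Icc (0 : ℝ) 1).domRestrict g) with hG
  have hGc : Continuous G := (continuousOn_iff_continuous_domRestrict.1 hgc).Icc_extend'
  have hGg : ∀ t ∈ Set.Icc (0 : ℝ) 1, G t = g t := fun t ht => by
    rw [hG, Set.IccExtend_of_mem _ _ ht]; rfl
  have hint : ∫ t in Set.Icc (0 : ℝ) 1, g t = ∫ t in (0 : ℝ)..1, G t := by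
    rw [intervalIntegral.integral_of_le zero_le_one, MeasureTheory.integral_Icc_eq_integral_Ioc]
    exact MeasureTheory.setIntegral_congr_fun measurableSet_Ioc
      fun t ht => (hGg t ⟨ht.1.le, ht.2⟩).symm
  rw [hint]
  have hDn : ∀ x y, 0 ≤ D x y := fun x y => by
    have := hDt x y x
    rw [hD0, hDc y x] at this
    linarith
  have habs : ∀ x y z, |D x y - D x z| ≤ D y z := fun x y z => by
    rw [abs_le]
    constructor
    · linarith [hDt x y z]
    · linarith [hDt x z y, hDc z y]
  have hdu : ∀ t ∈ Set.Icc (0 : ℝ) 1,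
      HasDerivWithinAt (Φ ∘ c) (derivWithin (Φ ∘ c) (Set.Icc 0 1) t) (Set.Icc 0 1) t :=
    fun t ht => (hu.differentiableOn one_ne_zero t ht).hasDerivWithinAt
  refine image_le_of_liminf_slope_right_le_deriv_boundary (f := fun t => D (c 0) (c t))
    (B := fun t => ∫ s in (0 : ℝ)..t, G s) (B' := G) (a := 0) (b := 1) ?_ ?_ ?_ ?_ ?_
    (x := 1) ⟨zero_le_one, le_rfl⟩
  · intro t ht
    have h1 : ∀ᶠ z in 𝓝[Set.Icc 0 1] t, |D (c 0) (c z) - D (c 0) (c t)| ≤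
        2 * ‖(Φ ∘ c) z - (Φ ∘ c) t‖ := by
      filter_upwards [(hc t ht).eventually (hloc (c t) 2 one_lt_two)] with z hz
      rw [abs_sub_comm]
      exact (habs _ _ _).trans hz
    have h2 : Tendsto (fun z => 2 * ‖(Φ ∘ c) z - (Φ ∘ c) t‖) (𝓝[Set.Icc 0 1] t) (𝓝 0) := by
      have h3 : ContinuousWithinAt (fun z => 2 * ‖(Φ ∘ c) z - (Φ ∘ c) t‖) (Set.Icc 0 1) t :=
        (((hu.continuousOn t ht).sub continuousWithinAt_const).norm).const_mul 2
      simpa [ContinuousWithinAt] using h3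
    have h4 := squeeze_zero' (Eventually.of_forall fun z => abs_nonneg _) h1 h2
    have h5 := (tendsto_zero_iff_abs_tendsto_zero _).2 h4
    have h6 := h5.add_const (D (c 0) (c t))
    simpa [ContinuousWithinAt] using h6
  · simp [hD0]
  · exact (intervalIntegral.continuous_primitive (fun a b => hGc.intervalIntegrable a b) 0).continuousOn
  · intro t _
    exact (hGc.integral_hasStrictDerivAt 0 t).hasDerivAt.hasDerivWithinAt
  · intro t ht r hr
    have ht' : t ∈ Set.Icc (0 : ℝ) 1 := ⟨ht.1, ht.2.le⟩
    rw [hGg t ht'] at hr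
    obtain ⟨r', hr1, hr2⟩ := exists_between hr
    have hr0 : 0 < r' := lt_of_le_of_lt (norm_nonneg _) hr1
    have hK : 1 < r / r' := (one_lt_div hr0).2 hr2
    have hle : 𝓝[>] t ≤ 𝓝[Set.Icc 0 1] t := by
      rw [← nhdsWithin_Ioc_eq_nhdsGT ht.2]
      exact nhdsWithin_mono _ fun z hz => ⟨ht.1.trans hz.1.le, hz.2⟩
    have e1 := hle ((hc t ht').eventually (hloc (c t) (r / r') hK))
    have e2 := hle ((hdu t ht').limsup_norm_slope_le hr1)
    refine Eventually.frequently ?_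
    filter_upwards [e1, e2, self_mem_nhdsWithin] with z h1 h2 (h3 : t < z)
    have h3' : 0 < z - t := sub_pos.2 h3
    rw [Real.norm_of_nonneg h3'.le, inv_mul_lt_iff₀ h3'] at h2
    rw [slope_def_field, div_lt_iff₀ h3']
    calc D (c 0) (c z) - D (c 0) (c t) ≤ D (c t) (c z) := by linarith [hDt (c 0) (c t) (c z)]
      _ ≤ r / r' * ‖Φ (c z) - Φ (c t)‖ := h1
      _ < r / r' * ((z - t) * r') := by
          exact mul_lt_mul_of_pos_left h2 (by positivity)
      _ = r * (z - t) := by field_simp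

/-- Criterion for a distance to be the Riemannian distance of an immersed manifold. -/
theorem pullbackEMetric_edist [FiniteDimensional ℝ E] [IsManifold I ∞ M] [T3Space M] {Φ : M → V}
    (hΦ : ContMDiff I 𝓘(ℝ, V) ∞ Φ) (hinj : ∀ x, Function.Injective (mvfderiv I Φ x))
    {D : M → M → ℝ} (hD0 : ∀ x, D x x = 0) (hDc : ∀ x y, D x y = D y x)
    (hDt : ∀ x y z, D x z ≤ D x y + D y z)
    (hloc : ∀ x, ∀ K : ℝ, 1 < K → ∀ᶠ y in 𝓝 x, D x y ≤ K * ‖Φ y - Φ x‖)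
    (hgeo : ∀ x y, ∃ c : ℝ → M, ContMDiff 𝓘(ℝ) I 1 c ∧ c 0 = x ∧ c 1 = y ∧
      ∀ t, ‖deriv (Φ ∘ c) t‖ ≤ D x y) (x y : M) :
    (pullbackEMetric hΦ hinj).edist x y = ENNReal.ofReal (D x y) := by
  let _ := pullbackBundle hΦ hinj
  change Manifold.riemannianEDist I x y = _
  have hsm : ∀ {c : ℝ → M}, ContMDiffOn 𝓘(ℝ) I 1 c (Set.Icc 0 1) →
      ContDiffOn ℝ 1 (Φ ∘ c) (Set.Icc 0 1) := fun hc =>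
    contMDiffOn_iff_contDiffOn.1 ((hΦ.of_le (by simp)).comp_contMDiffOn hc)
  apply le_antisymm
  · obtain ⟨c, hc, h0, h1, hn⟩ := hgeo x y
    refine (Manifold.riemannianEDist_le_pathELength hc.contMDiffOn h0 h1 zero_le_one).trans ?_
    rw [pathELength_pullbackMetric hΦ hinj hc.contMDiffOn]
    have hcd : ContDiff ℝ 1 (Φ ∘ c) := contMDiff_iff_contDiff.1 ((hΦ.of_le (by simp)).comp hc)
    calc _ ≤ ∫⁻ t in Set.Icc (0 : ℝ) 1, ENNReal.ofReal (D x y) := by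
            refine MeasureTheory.setLIntegral_mono' measurableSet_Icc fun t ht => ?_
            rw [(hcd.differentiable one_ne_zero t).derivWithin
              (uniqueDiffOn_Icc zero_lt_one t ht), ← ofReal_norm]
            exact ENNReal.ofReal_le_ofReal (hn t)
      _ = _ := by simp
  · refine le_of_forall_gt fun r hr => ?_
    obtain ⟨c, h0, h1, hc, hl, -⟩ :=
      Manifold.exists_lt_locally_constant_of_riemannianEDist_lt hr zero_lt_one
    refine lt_of_le_of_lt ?_ hl
    rw [pathELength_pullbackMetric hΦ hinj hc.contMDiffOn]
    have hu := hsm hc.contMDiffOn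
    have := le_integral_norm_deriv_of_local_bound hD0 hDc hDt hloc hc.continuous.continuousOn hu
    rw [h0, h1] at this
    refine (ENNReal.ofReal_le_ofReal this).trans_eq ?_
    refine MeasureTheory.ofReal_integral_norm_eq_lintegral_enorm ?_
    exact (hu.continuousOn_derivWithin (uniqueDiffOn_Icc zero_lt_one) le_rfl).integrableOn_Icc

end PullbackDistance

theorem sqrt_add_sq_le (a b c d : ℝ) :
    √((a + c) ^ 2 + (b + d) ^ 2) ≤ √(a ^ 2 + b ^ 2) + √(c ^ 2 + d ^ 2) := by
  have h := norm_add_le (a + b * Complex.I) (c + d * Complex.I)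
  have e : (a + b * Complex.I) + (c + d * Complex.I) =
      ((a + c : ℝ) : ℂ) + ((b + d : ℝ) : ℂ) * Complex.I := by push_cast; ring
  rwa [e, Complex.norm_add_mul_I, Complex.norm_add_mul_I, Complex.norm_add_mul_I] at h

section SphereGeometry
open InnerProductGeometry Filter Topology

variable {E : Type*} [NormedAddCommGroup E] [InnerProductSpace ℝ E]

theorem cos_angle_of_unit {x y : E} (hx : ‖x‖ = 1) (hy : ‖y‖ = 1) :
    Real.cos (angle x y) = inner ℝ x y := by
  rw [cos_angle, hx, hy]; simp

theorem norm_sub_eq_two_mul_sin {x y : E} (hx : ‖x‖ = 1) (hy : ‖y‖ = 1) :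
    ‖x - y‖ = 2 * Real.sin (angle x y / 2) := by
  have h0 : 0 ≤ Real.sin (angle x y / 2) :=
    Real.sin_nonneg_of_nonneg_of_le_pi (by linarith [angle_nonneg x y])
      (by linarith [angle_le_pi x y, Real.pi_pos])
  have h1 : ‖x - y‖ ^ 2 = (2 * Real.sin (angle x y / 2)) ^ 2 := by
    rw [norm_sub_sq_real, hx, hy, ← cos_angle_of_unit hx hy, mul_pow, Real.sin_sq_eq_half_sub]
    rw [mul_div_cancel₀ _ (two_ne_zero)]
    ring
  exact (sq_eq_sq₀ (norm_nonneg _) (by positivity)).1 h1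

theorem norm_sub_le_angle {x y : E} (hx : ‖x‖ = 1) (hy : ‖y‖ = 1) : ‖x - y‖ ≤ angle x y := by
  rw [norm_sub_eq_two_mul_sin hx hy]
  linarith [Real.sin_le (by linarith [angle_nonneg x y] : 0 ≤ angle x y / 2)]

theorem eventually_angle_le (x : Metric.sphere (0 : E) 1) {K : ℝ} (hK : 1 < K) :
    ∀ᶠ y : Metric.sphere (0 : E) 1 in 𝓝 x, angle (x : E) y ≤ K * ‖(y : E) - x‖ := by
  have hu : ∀ z : Metric.sphere (0 : E) 1, ‖(z : E)‖ = 1 := fun z => by simp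
  have hne : ∀ z : Metric.sphere (0 : E) 1, (z : E) ≠ 0 := fun z h => by
    have := hu z; rw [h, norm_zero] at this; exact zero_ne_one this
  have hcont : Tendsto (fun y : Metric.sphere (0 : E) 1 => angle (x : E) y) (𝓝 x) (𝓝 0) := by
    have h1 : ContinuousAt (fun y : Metric.sphere (0 : E) 1 => angle (x : E) y) x :=
      ContinuousAt.comp (f := fun y : Metric.sphere (0 : E) 1 => ((x : E), (y : E)))
        (g := fun p : E × E => angle p.1 p.2) (continuousAt_angle (hne x) (hne x))
        (by fun_prop)
    have h2 := h1.tendsto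
    rwa [angle_self (hne x)] at h2
  have h2 : Tendsto (fun θ : ℝ => K * (1 - θ ^ 2 / 16)) (𝓝 0) (𝓝 K) := by
    have : Continuous fun θ : ℝ => K * (1 - θ ^ 2 / 16) := by fun_prop
    simpa using this.tendsto 0
  have e1 := hcont.eventually (h2.eventually (lt_mem_nhds hK))
  have e2 := hcont.eventually (gt_mem_nhds (zero_lt_one (α := ℝ)))
  filter_upwards [e1, e2] with y h3 h4
  rw [norm_sub_rev, norm_sub_eq_two_mul_sin (hu x) (hu y)]
  set θ := angle (x : E) (y : E)
  rcases (angle_nonneg (x : E) (y : E)).eq_or_lt with h0 | h0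
  · simp [θ, ← h0]
  · have h5 := Real.sin_gt_sub_cube (x := θ / 2) (by positivity)
    nlinarith [pow_pos h0 3]

theorem exists_orthogonal_unit [FiniteDimensional ℝ E] (hd : 2 ≤ Module.finrank ℝ E) (x : E) :
    ∃ v : E, ‖v‖ = 1 ∧ inner ℝ x v = 0 := by
  have h : (ℝ ∙ x)ᗮ ≠ ⊥ := by
    intro h
    have h1 := Submodule.finrank_add_finrank_orthogonal (ℝ ∙ x)
    rw [h, finrank_bot] at h1
    have h2 : Module.finrank ℝ (ℝ ∙ x) ≤ 1 := by
      simpa using finrank_span_le_card (R := ℝ) ({x} : Set E)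
    omega
  obtain ⟨w, hw, hw0⟩ := Submodule.exists_mem_ne_zero_of_ne_bot h
  refine ⟨‖w‖⁻¹ • w, norm_smul_inv_norm hw0, ?_⟩
  rw [inner_smul_right, Submodule.mem_orthogonal_singleton_iff_inner_right.1 hw, mul_zero]

theorem exists_eq_cos_add_sin [FiniteDimensional ℝ E] (hd : 2 ≤ Module.finrank ℝ E) {x y : E}
    (hx : ‖x‖ = 1) (hy : ‖y‖ = 1) : ∃ v : E, ‖v‖ = 1 ∧ inner ℝ x v = 0 ∧
      y = Real.cos (angle x y) • x + Real.sin (angle x y) • v := by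
  have hc := cos_angle_of_unit hx hy
  set w := y - Real.cos (angle x y) • x with hw
  have hxw : inner ℝ x w = 0 := by
    rw [hw, inner_sub_right, inner_smul_right, real_inner_self_eq_norm_sq, hx, hc]; ring
  have hnw : ‖w‖ = Real.sin (angle x y) := by
    have h1 : ‖w‖ ^ 2 = Real.sin (angle x y) ^ 2 := by
      rw [hw, norm_sub_sq_real, inner_smul_right, real_inner_comm, ← hc, norm_smul, hx, hy,
        Real.sin_sq, mul_one, Real.norm_eq_abs, sq_abs]
      ring
    exact (sq_eq_sq₀ (norm_nonneg _) (sin_angle_nonneg x y)).1 h1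
  by_cases h0 : w = 0
  · obtain ⟨v, hv, hxv⟩ := exists_orthogonal_unit hd x
    refine ⟨v, hv, hxv, ?_⟩
    rw [← hnw, h0, norm_zero, zero_smul, add_zero]
    exact sub_eq_zero.1 h0
  · refine ⟨‖w‖⁻¹ • w, norm_smul_inv_norm h0, by rw [inner_smul_right, hxw, mul_zero], ?_⟩
    rw [← hnw, smul_smul, mul_inv_cancel₀ (norm_ne_zero_iff.2 h0), one_smul, hw]
    abel

theorem norm_cos_add_sin {x v : E} (hx : ‖x‖ = 1) (hv : ‖v‖ = 1) (hxv : inner ℝ x v = 0) (a : ℝ) :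
    ‖Real.cos a • x + Real.sin a • v‖ = 1 := by
  have : ‖Real.cos a • x + Real.sin a • v‖ ^ 2 = 1 := by
    rw [norm_add_sq_real, inner_smul_left, inner_smul_right, hxv, norm_smul, norm_smul, hx, hv]
    simp
  nlinarith [norm_nonneg (Real.cos a • x + Real.sin a • v)]

theorem inner_cos_add_sin {x v : E} (hx : ‖x‖ = 1) (hv : ‖v‖ = 1) (hxv : inner ℝ x v = 0)
    (a b : ℝ) : inner ℝ (Real.cos a • x + Real.sin a • v) (Real.cos b • x + Real.sin b • v) =
      Real.cos (a - b) := by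
  have hvx : inner ℝ v x = 0 := by rw [real_inner_comm, hxv]
  simp only [inner_add_left, inner_add_right, inner_smul_left, inner_smul_right, hxv, hvx,
    real_inner_self_eq_norm_sq, hx, hv, Real.cos_sub]
  simp; ring

theorem angle_eq_of_inner {x y : E} (hx : ‖x‖ = 1) (hy : ‖y‖ = 1) {a : ℝ} (h0 : 0 ≤ a)
    (hp : a ≤ Real.pi) (h : inner ℝ x y = Real.cos a) : angle x y = a := by
  rw [angle, hx, hy, h]; simpa using Real.arccos_cos h0 hp

theorem angle_cos_add_sin {x v : E} (hx : ‖x‖ = 1) (hv : ‖v‖ = 1) (hxv : inner ℝ x v = 0)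
    {a b : ℝ} (h : |a - b| ≤ Real.pi) :
    angle (Real.cos a • x + Real.sin a • v) (Real.cos b • x + Real.sin b • v) = |a - b| :=
  angle_eq_of_inner (norm_cos_add_sin hx hv hxv a) (norm_cos_add_sin hx hv hxv b) (abs_nonneg _) h
    (by rw [inner_cos_add_sin hx hv hxv, Real.cos_abs])

end SphereGeometry

theorem norm_toLp_prod {E F : Type*} [SeminormedAddCommGroup E] [SeminormedAddCommGroup F]
    (a : E) (b : F) : ‖WithLp.toLp 2 (a, b)‖ = √(‖a‖ ^ 2 + ‖b‖ ^ 2) := by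
  rw [WithLp.prod_norm_eq_of_L2]; rfl

section SphereProduct
open InnerProductGeometry Filter Topology Metric

variable {E : Type} [NormedAddCommGroup E] [InnerProductSpace ℝ E]
  {F : Type} [NormedAddCommGroup F] [InnerProductSpace ℝ F]

/-- The immersion of a product of unit spheres as a product of spheres of radii `r` and `s`. -/
def sphereImmersion (E F : Type) [NormedAddCommGroup E] [InnerProductSpace ℝ E]
    [NormedAddCommGroup F] [InnerProductSpace ℝ F] (r s : ℝ) (p : sphere (0 : E) 1 × sphere (0 : F) 1) :
    WithLp 2 (E × F) := WithLp.toLp 2 (r • (p.1 : E), s • (p.2 : F))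

/-- The distance of a product of spheres of radii `r` and `s`. -/
def sphereDist (r s : ℝ) (p q : sphere (0 : E) 1 × sphere (0 : F) 1) : ℝ :=
  √((r * angle (p.1 : E) q.1) ^ 2 + (s * angle (p.2 : F) q.2) ^ 2)

variable {m n : ℕ} [Fact (Module.finrank ℝ E = m + 1)] [Fact (Module.finrank ℝ F = n + 1)]

theorem contMDiff_sphereImmersion (r s : ℝ) :
    ContMDiff ((𝓡 m).prod (𝓡 n)) 𝓘(ℝ, WithLp 2 (E × F)) ∞ (sphereImmersion E F r s) := by
  have h1 : ContMDiff ((𝓡 m).prod (𝓡 n)) 𝓘(ℝ, E) ∞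
      fun p : sphere (0 : E) 1 × sphere (0 : F) 1 => (p.1 : E) :=
    contMDiff_coe_sphere.comp contMDiff_fst
  have h2 : ContMDiff ((𝓡 m).prod (𝓡 n)) 𝓘(ℝ, F) ∞
      fun p : sphere (0 : E) 1 × sphere (0 : F) 1 => (p.2 : F) :=
    contMDiff_coe_sphere.comp contMDiff_snd
  have h3 := h1.prodMk_space h2
  have h4 : ContDiff ℝ ∞ fun w : E × F => WithLp.toLp 2 (r • w.1, s • w.2) :=
    (WithLp.prodContinuousLinearEquiv 2 ℝ E F).symm.contDiff.comp (by fun_prop)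
  exact h4.contMDiff.comp h3

theorem injective_mvfderiv_sphereImmersion {r s : ℝ} (hr : 0 < r) (hs : 0 < s)
    (p : sphere (0 : E) 1 × sphere (0 : F) 1) :
    Function.Injective (mvfderiv ((𝓡 m).prod (𝓡 n)) (sphereImmersion E F r s) p) := by
  have hd : MDifferentiableAt ((𝓡 m).prod (𝓡 n)) 𝓘(ℝ, WithLp 2 (E × F))
      (sphereImmersion E F r s) p := (contMDiff_sphereImmersion r s).mdifferentiableAt (by simp)
  rw [injective_iff_map_eq_zero]
  intro v hv
  have hv' : mfderiv ((𝓡 m).prod (𝓡 n)) 𝓘(ℝ, WithLp 2 (E × F)) (sphereImmersion E F r s) p v = 0 := hv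
  have h1 : v.1 = 0 := by
    let T : WithLp 2 (E × F) →L[ℝ] E := r⁻¹ • WithLp.fstL 2 ℝ E F
    have e1 : (fun x : sphere (0 : E) 1 => (x : E)) ∘ Prod.fst = (T ∘ sphereImmersion E F r s) := by
      ext q; simp [T, sphereImmersion, smul_smul, inv_mul_cancel₀ hr.ne']
    have e2 := T.hasMFDerivAt.comp p hd.hasMFDerivAt
    have e3 := ((contMDiff_coe_sphere (n := m) (E := E) (m := 1) p.1).mdifferentiableAt
      one_ne_zero).hasMFDerivAt.comp p (hasMFDerivAt_fst (I := 𝓡 m) (I' := 𝓡 n) (x := p))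
    rw [e1] at e3
    have e4 := congr($(hasMFDerivAt_unique e2 e3) v)
    exact injective_mvfderiv_subtypeVal_sphere (n := m) p.1
      ((e4.symm.trans ((congrArg T hv').trans (map_zero T))).trans 
        (mvfderiv (𝓡 m) (Subtype.val : sphere (0 : E) 1 → E) p.1).map_zero.symm)
  have h2 : v.2 = 0 := by
    let T : WithLp 2 (E × F) →L[ℝ] F := s⁻¹ • WithLp.sndL 2 ℝ E F
    have e1 : (fun x : sphere (0 : F) 1 => (x : F)) ∘ Prod.snd = (T ∘ sphereImmersion E F r s) := by
      ext q; simp [T, sphereImmersion, smul_smul, inv_mul_cancel₀ hs.ne']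
    have e2 := T.hasMFDerivAt.comp p hd.hasMFDerivAt
    have e3 := ((contMDiff_coe_sphere (n := n) (E := F) (m := 1) p.2).mdifferentiableAt
      one_ne_zero).hasMFDerivAt.comp p (hasMFDerivAt_snd (I := 𝓡 m) (I' := 𝓡 n) (x := p))
    rw [e1] at e3
    have e4 := congr($(hasMFDerivAt_unique e2 e3) v)
    exact injective_mvfderiv_subtypeVal_sphere (n := n) p.2
      ((e4.symm.trans ((congrArg T hv').trans (map_zero T))).trans 
        (mvfderiv (𝓡 n) (Subtype.val : sphere (0 : F) 1 → F) p.2).map_zero.symm)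
  exact Prod.ext h1 h2

/-- The product of two round spheres, as a closed Riemannian manifold. -/
def sphereProd (m n : ℕ) (E F : Type) [NormedAddCommGroup E] [InnerProductSpace ℝ E]
    [NormedAddCommGroup F] [InnerProductSpace ℝ F]
    [Fact (Module.finrank ℝ E = m + 1)] [Fact (Module.finrank ℝ F = n + 1)]
    (hm : 1 ≤ m) (hn : 1 ≤ n) {r s : ℝ} (hr : 0 < r) (hs : 0 < s) : ClosedRiemannianManifold :=
  have hE : Module.finrank ℝ E = m + 1 := Fact.out
  have hF : Module.finrank ℝ F = n + 1 := Fact.out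
  haveI : FiniteDimensional ℝ E := Module.finite_of_finrank_eq_succ hE
  haveI : FiniteDimensional ℝ F := Module.finite_of_finrank_eq_succ hF
  haveI : ConnectedSpace (sphere (0 : E) 1) := Subtype.connectedSpace
    (isConnected_sphere (by rw [← Module.finrank_eq_rank, hE]; exact_mod_cast (by omega)) 0
      zero_le_one)
  haveI : ConnectedSpace (sphere (0 : F) 1) := Subtype.connectedSpace
    (isConnected_sphere (by rw [← Module.finrank_eq_rank, hF]; exact_mod_cast (by omega)) 0
      zero_le_one)
  haveI : IsManifold ((𝓡 m).prod (𝓡 n)) ∞ (sphere (0 : E) 1 × sphere (0 : F) 1) := inferInstance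
  haveI : BoundarylessManifold ((𝓡 m).prod (𝓡 n)) (sphere (0 : E) 1 × sphere (0 : F) 1) := inferInstance
  haveI : T3Space (sphere (0 : E) 1 × sphere (0 : F) 1) := inferInstance
  haveI : CompactSpace (sphere (0 : E) 1 × sphere (0 : F) 1) := inferInstance
  haveI : ConnectedSpace (sphere (0 : E) 1 × sphere (0 : F) 1) := inferInstance
  ClosedRiemannianManifold.ofImmersion (I := (𝓡 m).prod (𝓡 n)) (M := sphere (0 : E) 1 × sphere (0 : F) 1)
    (Φ := sphereImmersion E F r s) (contMDiff_sphereImmersion (m := m) (n := n) r s)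
    (injective_mvfderiv_sphereImmersion (m := m) (n := n) hr hs)

theorem sphereDist_self (r s : ℝ) (p : sphere (0 : E) 1 × sphere (0 : F) 1) :
    sphereDist r s p p = 0 := by
  have h1 : (p.1 : E) ≠ 0 := fun h => by simpa [h] using norm_eq_of_mem_sphere p.1
  have h2 : (p.2 : F) ≠ 0 := fun h => by simpa [h] using norm_eq_of_mem_sphere p.2
  simp [sphereDist, angle_self h1, angle_self h2]

theorem sphereDist_comm (r s : ℝ) (p q : sphere (0 : E) 1 × sphere (0 : F) 1) :
    sphereDist r s p q = sphereDist r s q p := by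
  simp only [sphereDist, angle_comm]

theorem sphereDist_triangle {r s : ℝ} (hr : 0 ≤ r) (hs : 0 ≤ s)
    (p q w : sphere (0 : E) 1 × sphere (0 : F) 1) :
    sphereDist r s p w ≤ sphereDist r s p q + sphereDist r s q w := by
  refine le_trans ?_ (sqrt_add_sq_le _ _ _ _)
  rw [← mul_add, ← mul_add]
  refine Real.sqrt_le_sqrt ?_
  have := angle_le_angle_add_angle (p.1 : E) q.1 w.1
  have := angle_le_angle_add_angle (p.2 : F) q.2 w.2
  have := angle_nonneg (p.1 : E) w.1
  have := angle_nonneg (p.2 : F) w.2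
  gcongr

theorem eventually_sphereDist_le {r s : ℝ} (hr : 0 ≤ r) (hs : 0 ≤ s)
    (p : sphere (0 : E) 1 × sphere (0 : F) 1) {K : ℝ} (hK : 1 < K) :
    ∀ᶠ q in 𝓝 p, sphereDist r s p q ≤ K * ‖sphereImmersion E F r s q - sphereImmersion E F r s p‖ := by
  have e1 := (continuous_fst.tendsto p).eventually (eventually_angle_le p.1 hK)
  have e2 := (continuous_snd.tendsto p).eventually (eventually_angle_le p.2 hK)
  filter_upwards [e1, e2] with q h1 h2
  have h3 : sphereImmersion E F r s q - sphereImmersion E F r s p =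
      WithLp.toLp 2 (r • ((q.1 : E) - p.1), s • ((q.2 : F) - p.2)) := by
    rw [smul_sub, smul_sub]; rfl
  have hK0 : 0 ≤ K := by linarith
  rw [h3, norm_toLp_prod, norm_smul, norm_smul, Real.norm_of_nonneg hr, Real.norm_of_nonneg hs,
    sphereDist]
  nth_rewrite 1 [← Real.sqrt_sq hK0]
  rw [← Real.sqrt_mul (sq_nonneg K)]
  refine Real.sqrt_le_sqrt ?_
  have := angle_nonneg (p.1 : E) q.1
  have := angle_nonneg (p.2 : F) q.2
  calc _ ≤ (r * (K * ‖(q.1 : E) - p.1‖)) ^ 2 + (s * (K * ‖(q.2 : F) - p.2‖)) ^ 2 := by gcongr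
    _ = _ := by ring

theorem hasDerivAt_cos_add_sin (θ t : ℝ) (x v : E) :
    HasDerivAt (fun t : ℝ => Real.cos (t * θ) • x + Real.sin (t * θ) • v)
      (θ • (-Real.sin (t * θ) • x + Real.cos (t * θ) • v)) t := by
  have h := hasDerivAt_mul_const (x := t) θ
  have := (h.cos.smul_const x).add (h.sin.smul_const v)
  exact this.congr_deriv (by module)

theorem norm_deriv_cos_add_sin {x v : E} (hx : ‖x‖ = 1) (hv : ‖v‖ = 1) (hxv : inner ℝ x v = 0)
    (a : ℝ) : ‖-Real.sin a • x + Real.cos a • v‖ = 1 := by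
  have := norm_cos_add_sin hv (x := v) (v := -x) (by rwa [norm_neg])
    (by rw [inner_neg_right, real_inner_comm, hxv, neg_zero]) a
  rw [← this]
  congr 1
  module

theorem exists_sphere_path {E : Type} [NormedAddCommGroup E] [InnerProductSpace ℝ E] {m : ℕ}
    [hE : Fact (Module.finrank ℝ E = m + 1)] (hm : 1 ≤ m) (x y : sphere (0 : E) 1) :
    ∃ c : ℝ → sphere (0 : E) 1, ContMDiff 𝓘(ℝ) (𝓡 m) 1 c ∧ c 0 = x ∧ c 1 = y ∧
      ∀ t, ∃ d : E, HasDerivAt (fun t => (c t : E)) d t ∧ ‖d‖ = angle (x : E) y := by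
  have : FiniteDimensional ℝ E := Module.finite_of_finrank_eq_succ hE.out
  have hx : ‖(x : E)‖ = 1 := by simp
  have hy : ‖(y : E)‖ = 1 := by simp
  obtain ⟨v, hv, hxv, hxy⟩ := exists_eq_cos_add_sin (by rw [hE.out]; omega) hx hy
  set θ := angle (x : E) y with hθ
  have hmem : ∀ t : ℝ, Real.cos (t * θ) • (x : E) + Real.sin (t * θ) • v ∈ sphere (0 : E) 1 :=
    fun t => by rw [mem_sphere_zero_iff_norm]; exact norm_cos_add_sin hx hv hxv _
  have hsm : ContDiff ℝ 1 fun t : ℝ => Real.cos (t * θ) • (x : E) + Real.sin (t * θ) • v := by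
    fun_prop
  refine ⟨Set.codRestrict _ _ hmem, hsm.contMDiff.codRestrict_sphere hmem, ?_, ?_, fun t => ?_⟩
  · ext; simp
  · ext; simp [← hxy]
  · refine ⟨_, hasDerivAt_cos_add_sin θ t (x : E) v, ?_⟩
    rw [norm_smul, norm_deriv_cos_add_sin hx hv hxv, mul_one, Real.norm_of_nonneg (angle_nonneg _ _)]

theorem exists_sphereProd_path (hm : 1 ≤ m) (hn : 1 ≤ n) {r s : ℝ} (hr : 0 < r) (hs : 0 < s)
    (p q : sphere (0 : E) 1 × sphere (0 : F) 1) :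
    ∃ c : ℝ → sphere (0 : E) 1 × sphere (0 : F) 1, ContMDiff 𝓘(ℝ) ((𝓡 m).prod (𝓡 n)) 1 c ∧
      c 0 = p ∧ c 1 = q ∧ ∀ t, ‖deriv (sphereImmersion E F r s ∘ c) t‖ ≤ sphereDist r s p q := by
  obtain ⟨c₁, hc₁, h₁0, h₁1, hd₁⟩ := exists_sphere_path hm p.1 q.1
  obtain ⟨c₂, hc₂, h₂0, h₂1, hd₂⟩ := exists_sphere_path hn p.2 q.2
  refine ⟨fun t => (c₁ t, c₂ t), hc₁.prodMk hc₂, Prod.ext h₁0 h₂0, Prod.ext h₁1 h₂1, fun t => ?_⟩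
  obtain ⟨d₁, hd₁, hn₁⟩ := hd₁ t
  obtain ⟨d₂, hd₂, hn₂⟩ := hd₂ t
  have h := (WithLp.prodContinuousLinearEquiv 2 ℝ E F).symm.hasFDerivAt.comp_hasDerivAt t
    ((hd₁.const_smul r).prodMk (hd₂.const_smul s))
  have h' : HasDerivAt (sphereImmersion E F r s ∘ fun t => (c₁ t, c₂ t))
    (WithLp.toLp 2 (r • d₁, s • d₂)) t := h
  rw [h'.deriv, norm_toLp_prod, norm_smul, norm_smul, hn₁, hn₂, Real.norm_of_nonneg hr.le,
    Real.norm_of_nonneg hs.le]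
  exact le_rfl

/-- A point of the product of two spheres. -/
def sphereProd.mk (hm : 1 ≤ m) (hn : 1 ≤ n) {r s : ℝ} (hr : 0 < r) (hs : 0 < s)
    (x : sphere (0 : E) 1) (y : sphere (0 : F) 1) : sphereProd m n E F hm hn hr hs :=
  show sphere (0 : E) 1 × sphere (0 : F) 1 from (x, y)

theorem sphereProd.exists_mk {hm : 1 ≤ m} {hn : 1 ≤ n} {r s : ℝ} {hr : 0 < r} {hs : 0 < s}
    (z : sphereProd m n E F hm hn hr hs) : ∃ x y, z = sphereProd.mk hm hn hr hs x y :=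
  ⟨_, _, rfl⟩

theorem sphereProd.edist_mk {hm : 1 ≤ m} {hn : 1 ≤ n} {r s : ℝ} {hr : 0 < r} {hs : 0 < s}
    (x x' : sphere (0 : E) 1) (y y' : sphere (0 : F) 1) :
    edist (sphereProd.mk hm hn hr hs x y) (sphereProd.mk hm hn hr hs x' y') =
      ENNReal.ofReal (√((r * angle (x : E) x') ^ 2 + (s * angle (y : F) y') ^ 2)) := by
  have h := pullbackEMetric_edist (I := (𝓡 m).prod (𝓡 n))
    (contMDiff_sphereImmersion (E := E) (F := F) (m := m) (n := n) r s)
    (injective_mvfderiv_sphereImmersion (m := m) (n := n) hr hs) (D := sphereDist r s)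
    (sphereDist_self r s) (sphereDist_comm r s)
    (sphereDist_triangle hr.le hs.le) (fun p _ hK => eventually_sphereDist_le hr.le hs.le p hK)
    (exists_sphereProd_path hm hn hr hs) (x, y) (x', y')
  exact h

end SphereProduct

section CirclePoints
open InnerProductGeometry Metric

instance : Fact (Module.finrank ℝ ℂ = 1 + 1) := ⟨Complex.finrank_real_complex⟩

instance : Fact (Module.finrank ℝ (WithLp 2 (ℂ × ℝ)) = 2 + 1) :=
  ⟨by rw [(WithLp.linearEquiv 2 ℝ (ℂ × ℝ)).finrank_eq, Module.finrank_prod,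
    Complex.finrank_real_complex, Module.finrank_self]⟩

/-- The point `exp (2 π i t)` of the complex plane. -/
def unitCircleMap (t : UnitAddCircle) : ℂ := (AddCircle.toCircle t : ℂ)

theorem norm_unitCircleMap (t : UnitAddCircle) : ‖unitCircleMap t‖ = 1 := Circle.norm_coe _

theorem unitCircleMap_coe (x : ℝ) :
    unitCircleMap x = Complex.exp (2 * Real.pi * x * Complex.I) := by
  rw [unitCircleMap, AddCircle.toCircle_apply_mk, Circle.coe_exp]
  congr 1; push_cast; ring

theorem unitCircleMap_zero : unitCircleMap 0 = 1 := by
  simp [unitCircleMap]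

theorem inner_unitCircleMap (t t' : UnitAddCircle) :
    inner ℝ (unitCircleMap t) (unitCircleMap t') = Real.cos (2 * Real.pi * ‖t - t'‖) := by
  induction t using QuotientAddGroup.induction_on with | H a => ?_
  induction t' using QuotientAddGroup.induction_on with | H b => ?_
  have h1 : ‖((a : ℝ) : UnitAddCircle) - (b : ℝ)‖ = |(a - b) - round (a - b)| := by
    rw [← AddCircle.coe_sub, UnitAddCircle.norm_eq]
  have h2 : Real.cos (2 * Real.pi * |(a - b) - round (a - b)|) = Real.cos (2 * Real.pi * (a - b)) := by
    rw [← abs_of_pos Real.two_pi_pos, ← abs_mul, Real.cos_abs, abs_of_pos Real.two_pi_pos, mul_sub,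
      mul_comm _ (round (a - b) : ℝ)]
    exact Real.cos_sub_int_mul_two_pi _ _
  erw [h1, h2]
  change inner ℝ (unitCircleMap (a : ℝ)) (unitCircleMap (b : ℝ)) = _
  rw [unitCircleMap_coe, unitCircleMap_coe, Complex.inner, ← Complex.exp_conj, ← Complex.exp_add]
  have h3 : 2 * Real.pi * b * Complex.I + (starRingEnd ℂ) (2 * Real.pi * a * Complex.I) =
      ((2 * Real.pi * (b - a) : ℝ) : ℂ) * Complex.I := by
    simp [Complex.conj_ofNat]; ring
  rw [h3, Complex.exp_ofReal_mul_I_re, ← Real.cos_neg]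
  ring_nf

theorem norm_unitAddCircle_le (t : UnitAddCircle) : ‖t‖ ≤ 1 / 2 := by
  simpa using AddCircle.norm_le_half_period (p := (1 : ℝ)) one_ne_zero (x := t)

theorem angle_unitCircleMap (t t' : UnitAddCircle) :
    angle (unitCircleMap t) (unitCircleMap t') = 2 * Real.pi * ‖t - t'‖ :=
  angle_eq_of_inner (norm_unitCircleMap t) (norm_unitCircleMap t')
    (mul_nonneg Real.two_pi_pos.le (norm_nonneg _))
    (by nlinarith [norm_unitAddCircle_le (t - t'), Real.pi_pos]) (inner_unitCircleMap t t')

theorem edist_unitAddCircle (t t' : UnitAddCircle) : edist t t' = ENNReal.ofReal ‖t - t'‖ := by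
  rw [edist_dist, dist_eq_norm]

end CirclePoints

/-- The distance in a finite extended metric space, as a real number. -/
def realDist {X : Type u} [EMetricSpace X] (x y : X) : ℝ := (edist x y).toReal

/-- A closed Riemannian manifold with a closed geodesic `γ` of length one and a point `p`, having
the properties
required in the construction of the glued space; the index `0` plays a special role. -/
structure GluingPiece (i : ℝ≥0) where
  M : ClosedRiemannianManifold
  γ : UnitAddCircle → M
  p : M
  ψ : M → ℂ
  isometry : Isometry γ
  midpoint : ∀ x y : M, ∃ z, edist x z = edist x y / 2 ∧ edist z y = edist x y / 2
  lipschitz : LipschitzWith 16 ψ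
  ψ_γ : ∀ t, ψ (γ t) = unitCircleMap t
  ψ_p : ψ p = 1
  ψ_ne_zero_of_eq : i = 0 → ∀ z, ψ z ≠ 0
  ψ_ne_zero_of_near_γ : ∀ z t, edist z (γ t) ≤ 1 / 16 → ψ z ≠ 0
  ψ_ne_zero_of_near_p : ∀ z, edist z p ≤ 1 / 16 → ψ z ≠ 0
  le_edist : i = 0 → ∀ t, 1 / 4 ≤ edist p (γ t)
  edist_lt : i = 0 → ∀ t, edist p (γ t) < (3 / 8 : ℝ≥0)
  existsUnique_geodesic : 0 < i → ∀ t, ∃! c : Set.Icc (0 : ℝ) (3 / 8 + i : ℝ≥0) → M,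
    IsMinimizingGeodesic p (γ t) c
  homotopy : 0 < i → ∃ h : ℝ → UnitAddCircle → M, (∀ t, h 0 t = γ t) ∧ (∀ t, h 1 t = p) ∧
    (∀ s ∈ Set.Icc (0 : ℝ) 1, ∀ s' ∈ Set.Icc (0 : ℝ) 1, ∀ t,
      edist (h s t) (h s' t) ≤ ENNReal.ofReal (|s - s'| * (3 / 8 + i))) ∧
    (∀ s ∈ Set.Icc (0 : ℝ) 1, ∀ t t', edist (h s t) (h s t') ≤ edist t t')

section SphereProductFacts
open InnerProductGeometry Metric

variable {E : Type} [NormedAddCommGroup E] [InnerProductSpace ℝ E]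
  {F : Type} [NormedAddCommGroup F] [InnerProductSpace ℝ F]
  {m n : ℕ} [Fact (Module.finrank ℝ E = m + 1)] [Fact (Module.finrank ℝ F = n + 1)]

theorem exists_sphere_midpoint {E : Type} [NormedAddCommGroup E] [InnerProductSpace ℝ E] {m : ℕ}
    [hE : Fact (Module.finrank ℝ E = m + 1)] (hm : 1 ≤ m) (x y : sphere (0 : E) 1) :
    ∃ z : sphere (0 : E) 1, angle (x : E) z = angle (x : E) y / 2 ∧
      angle (z : E) y = angle (x : E) y / 2 := by
  have : FiniteDimensional ℝ E := Module.finite_of_finrank_eq_succ hE.out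
  have hx : ‖(x : E)‖ = 1 := by simp
  have hy : ‖(y : E)‖ = 1 := by simp
  obtain ⟨v, hv, hxv, hxy⟩ := exists_eq_cos_add_sin (by rw [hE.out]; omega) hx hy
  have h0 := angle_nonneg (x : E) y
  have hp := angle_le_pi (x : E) y
  generalize angle (x : E) y = θ at *
  refine ⟨⟨_, mem_sphere_zero_iff_norm.2 (norm_cos_add_sin hx hv hxv (θ / 2))⟩, ?_, ?_⟩
  · have := angle_cos_add_sin hx hv hxv (a := 0) (b := θ / 2)
      (by rw [abs_le]; constructor <;> linarith [Real.pi_pos])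
    rw [zero_sub, abs_neg, abs_of_nonneg (by linarith)] at this
    simpa using this
  · rw [hxy]
    have := angle_cos_add_sin hx hv hxv (a := θ / 2) (b := θ)
      (by rw [abs_le]; constructor <;> linarith [Real.pi_pos])
    rwa [show θ / 2 - θ = - (θ / 2) by ring, abs_neg, abs_of_nonneg (by linarith)] at this

theorem sphereProd.exists_midpoint {hm : 1 ≤ m} {hn : 1 ≤ n} {r s : ℝ} {hr : 0 < r} {hs : 0 < s}
    (z w : sphereProd m n E F hm hn hr hs) :
    ∃ q, edist z q = edist z w / 2 ∧ edist q w = edist z w / 2 := by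
  obtain ⟨x, y, rfl⟩ := sphereProd.exists_mk z
  obtain ⟨x', y', rfl⟩ := sphereProd.exists_mk w
  obtain ⟨a, ha, ha'⟩ := exists_sphere_midpoint hm x x'
  obtain ⟨b, hb, hb'⟩ := exists_sphere_midpoint hn y y'
  have key : ∀ c d : ℝ, ENNReal.ofReal √((r * (c / 2)) ^ 2 + (s * (d / 2)) ^ 2) =
      ENNReal.ofReal √((r * c) ^ 2 + (s * d) ^ 2) / 2 := fun c d => by
    rw [show (r * (c / 2)) ^ 2 + (s * (d / 2)) ^ 2 = ((r * c) ^ 2 + (s * d) ^ 2) / 2 ^ 2 by ring,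
      Real.sqrt_div' _ (by norm_num), Real.sqrt_sq (by norm_num),
      ENNReal.ofReal_div_of_pos (by norm_num)]
    simp
  refine ⟨sphereProd.mk hm hn hr hs a b, ?_, ?_⟩ <;>
  · simp only [sphereProd.edist_mk, ha, ha', hb, hb', key]

theorem sphereProd.edist_ne_top {hm : 1 ≤ m} {hn : 1 ≤ n} {r s : ℝ} {hr : 0 < r} {hs : 0 < s}
    (z w : sphereProd m n E F hm hn hr hs) : edist z w ≠ ⊤ := by
  obtain ⟨x, y, rfl⟩ := sphereProd.exists_mk z
  obtain ⟨x', y', rfl⟩ := sphereProd.exists_mk w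
  rw [sphereProd.edist_mk]
  exact ENNReal.ofReal_ne_top

end SphereProductFacts

section TorusPiece
open InnerProductGeometry Metric

theorem torusRadius_pos : 0 < 1 / (2 * Real.pi * √2) := by positivity

theorem sq_torusRadius : (1 / (2 * Real.pi * √2)) ^ 2 = 1 / (8 * Real.pi ^ 2) := by
  rw [div_pow, mul_pow, Real.sq_sqrt (by norm_num)]
  congr 1 <;> ring

/-- The flat torus which is the product of two circles of length `1 / √2`. -/
abbrev flatTorus : ClosedRiemannianManifold :=
  sphereProd 1 1 ℂ ℂ le_rfl le_rfl torusRadius_pos torusRadius_pos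

/-- The point of the unit sphere of `ℂ` with parameter `t`. -/
def circlePoint (t : UnitAddCircle) : sphere (0 : ℂ) 1 :=
  ⟨unitCircleMap t, by simpa using norm_unitCircleMap t⟩

/-- The point of the flat torus with given coordinates. -/
def torusPoint (x y : sphere (0 : ℂ) 1) : flatTorus := sphereProd.mk _ _ _ _ x y

theorem edist_torusPoint (x x' y y' : sphere (0 : ℂ) 1) :
    edist (torusPoint x y) (torusPoint x' y') = ENNReal.ofReal
      (√((1 / (2 * Real.pi * √2) * angle (x : ℂ) x') ^ 2 +
        (1 / (2 * Real.pi * √2) * angle (y : ℂ) y') ^ 2)) :=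
  sphereProd.edist_mk _ _ _ _

/-- The first coordinate of a point of the torus, in the complex plane. -/
def torusFst (z : flatTorus) : ℂ := ((show sphere (0 : ℂ) 1 × sphere (0 : ℂ) 1 from z).1 : ℂ)

theorem torusFst_ne_zero (z : flatTorus) : torusFst z ≠ 0 := fun h => by
  have := norm_eq_of_mem_sphere (show sphere (0 : ℂ) 1 × sphere (0 : ℂ) 1 from z).1
  rw [show ((show sphere (0 : ℂ) 1 × sphere (0 : ℂ) 1 from z).1 : ℂ) = 0 from h, norm_zero] at this
  exact zero_ne_one this

theorem edist_pole_torusDiagonal (t : UnitAddCircle) :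
    edist (torusPoint (circlePoint 0) (-circlePoint 0)) (torusPoint (circlePoint t) (circlePoint t)) =
      ENNReal.ofReal √((1 / (2 * Real.pi * √2)) ^ 2 *
        ((2 * Real.pi * ‖t‖) ^ 2 + (Real.pi - 2 * Real.pi * ‖t‖) ^ 2)) := by
  rw [edist_torusPoint]
  have h1 : angle (circlePoint 0 : ℂ) (circlePoint t) = 2 * Real.pi * ‖t‖ := by
    have := angle_unitCircleMap 0 t
    rwa [zero_sub, norm_neg] at this
  have h2 : angle ((-circlePoint 0 : sphere (0 : ℂ) 1) : ℂ) (circlePoint t) =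
      Real.pi - 2 * Real.pi * ‖t‖ := by
    rw [← h1, ← angle_neg_left]; rfl
  rw [h1, h2]
  congr 2; ring

/-- The piece of index `0`: a flat torus and a diagonal in it. -/
def torusPiece : GluingPiece 0 where
  M := flatTorus
  γ t := torusPoint (circlePoint t) (circlePoint t)
  p := torusPoint (circlePoint 0) (-circlePoint 0)
  ψ := torusFst
  isometry t t' := by
    rw [edist_torusPoint, edist_unitAddCircle]
    change ENNReal.ofReal √((_ * angle (unitCircleMap t) (unitCircleMap t')) ^ 2 +
      (_ * angle (unitCircleMap t) (unitCircleMap t')) ^ 2) = _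
    rw [angle_unitCircleMap]
    congr 1
    rw [Real.sqrt_eq_iff_mul_self_eq (by positivity) (norm_nonneg _)]
    have := Real.pi_ne_zero
    field_simp
    rw [Real.sq_sqrt (by norm_num)]
    ring
  midpoint := sphereProd.exists_midpoint
  lipschitz z w := by
    obtain ⟨x, y, rfl⟩ := sphereProd.exists_mk z
    obtain ⟨x', y', rfl⟩ := sphereProd.exists_mk w
    change edist (x : ℂ) x' ≤ _ * edist (torusPoint x y) (torusPoint x' y')
    rw [edist_torusPoint, edist_dist, dist_eq_norm,
      show ((16 : ℝ≥0) : ℝ≥0∞) = ENNReal.ofReal 16 by simp,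
      ← ENNReal.ofReal_mul (by norm_num)]
    refine ENNReal.ofReal_le_ofReal ?_
    refine (norm_sub_le_angle (by simp) (by simp)).trans ?_
    have h0 := angle_nonneg (x : ℂ) x'
    have h1 : 1 / (2 * Real.pi * √2) * angle (x : ℂ) x' ≤
        √((1 / (2 * Real.pi * √2) * angle (x : ℂ) x') ^ 2 +
        (1 / (2 * Real.pi * √2) * angle (y : ℂ) y') ^ 2) :=
      Real.le_sqrt_of_sq_le (le_add_of_nonneg_right (sq_nonneg _))
    have h2 : 1 ≤ 16 * (1 / (2 * Real.pi * √2)) := by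
      rw [mul_one_div, one_le_div (by positivity)]
      have h3 : √2 ≤ 2 := by rw [Real.sqrt_le_left (by norm_num)]; norm_num
      nlinarith [Real.pi_le_four, Real.pi_pos, Real.sqrt_nonneg 2]
    calc angle (x : ℂ) x' ≤ (16 * (1 / (2 * Real.pi * √2))) * angle (x : ℂ) x' :=
          le_mul_of_one_le_left h0 h2
      _ = 16 * (1 / (2 * Real.pi * √2) * angle (x : ℂ) x') := by ring
      _ ≤ _ := by gcongr
  ψ_γ t := rfl
  ψ_p := unitCircleMap_zero
  ψ_ne_zero_of_eq _ := torusFst_ne_zero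
  ψ_ne_zero_of_near_γ z _ _ := torusFst_ne_zero z
  ψ_ne_zero_of_near_p z _ := torusFst_ne_zero z
  le_edist _ t := by
    rw [edist_pole_torusDiagonal, show (1 / 4 : ℝ≥0∞) = ENNReal.ofReal (1 / 4) by
      rw [ENNReal.ofReal_div_of_pos (by norm_num)]; simp]
    refine ENNReal.ofReal_le_ofReal (Real.le_sqrt_of_sq_le ?_)
    rw [sq_torusRadius, div_mul_eq_mul_div, le_div_iff₀ (by positivity)]
    nlinarith [sq_nonneg (2 * Real.pi * ‖t‖ - (Real.pi - 2 * Real.pi * ‖t‖))]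
  edist_lt _ t := by
    rw [edist_pole_torusDiagonal]
    rw [← ENNReal.ofReal_coe_nnreal]
    refine (ENNReal.ofReal_lt_ofReal_iff (by norm_num)).2 ?_
    rw [Real.sqrt_lt' (by norm_num)]
    rw [sq_torusRadius, div_mul_eq_mul_div, div_lt_iff₀ (by positivity)]
    have h1 := norm_unitAddCircle_le t
    have h2 := norm_nonneg t
    have h3 := sq_pos_of_pos Real.pi_pos
    have h4 : 0 ≤ ‖t‖ * (1 - 2 * ‖t‖) := mul_nonneg h2 (by linarith)
    push_cast
    nlinarith [mul_nonneg h3.le h4]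
  existsUnique_geodesic h := (lt_irrefl _ h).elim
  homotopy h := (lt_irrefl _ h).elim

end TorusPiece

/-- The equality case of the triangle inequality in the Euclidean plane. -/
theorem eq_of_minkowski_eq {u v σ τ A₁ A₂ B₁ B₂ : ℝ} (hu : 0 ≤ u) (hv : 0 ≤ v) (hσ : 0 ≤ σ)
    (hτ : 0 ≤ τ) (hl : 0 < σ + τ) (huv : u ^ 2 + v ^ 2 = (σ + τ) ^ 2) (h₁ : A₁ ^ 2 + B₁ ^ 2 = σ ^ 2)
    (h₂ : A₂ ^ 2 + B₂ ^ 2 = τ ^ 2) (hA : u ≤ A₁ + A₂) (hB : v ≤ B₁ + B₂) :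
    A₁ = σ / (σ + τ) * u ∧ B₁ = σ / (σ + τ) * v := by
  have cs : ∀ {a b ρ : ℝ}, 0 ≤ ρ → a ^ 2 + b ^ 2 = ρ ^ 2 → u * a + v * b ≤ (σ + τ) * ρ := by
    intro a b ρ hρ h
    refine abs_le_of_sq_le_sq' ?_ (by positivity) |>.2
    rw [mul_pow, ← huv, ← h]
    nlinarith [sq_nonneg (u * b - v * a)]
  have c1 := cs hσ h₁
  have c2 := cs hτ h₂
  have c3 : u * A₁ + v * B₁ = (σ + τ) * σ := by
    nlinarith [mul_le_mul_of_nonneg_left hA hu, mul_le_mul_of_nonneg_left hB hv]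
  have c4 : ((σ + τ) * A₁ - σ * u) ^ 2 + ((σ + τ) * B₁ - σ * v) ^ 2 = 0 := by
    have : ((σ + τ) * A₁ - σ * u) ^ 2 + ((σ + τ) * B₁ - σ * v) ^ 2 =
      (σ + τ) ^ 2 * (A₁ ^ 2 + B₁ ^ 2) - 2 * (σ + τ) * σ * (u * A₁ + v * B₁)
        + σ ^ 2 * (u ^ 2 + v ^ 2) := by ring
    rw [this, h₁, c3, huv]; ring
  have c5 : (σ + τ) * A₁ - σ * u = 0 := by
    nlinarith [sq_nonneg ((σ + τ) * A₁ - σ * u), sq_nonneg ((σ + τ) * B₁ - σ * v)]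
  have c6 : (σ + τ) * B₁ - σ * v = 0 := by
    nlinarith [sq_nonneg ((σ + τ) * A₁ - σ * u), sq_nonneg ((σ + τ) * B₁ - σ * v)]
  constructor
  · field_simp; linarith
  · field_simp; linarith

section CapPiece
open InnerProductGeometry Metric

theorem eq_cos_add_sin_of_angle {E : Type*} [NormedAddCommGroup E] [InnerProductSpace ℝ E]
    {x v z : E} (hx : ‖x‖ = 1) (hv : ‖v‖ = 1) (hz : ‖z‖ = 1) (hxv : inner ℝ x v = 0) {a : ℝ}
    (h₁ : angle x z = a) (h₂ : angle z v = Real.pi / 2 - a) :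
    z = Real.cos a • x + Real.sin a • v := by
  have e1 := cos_angle_of_unit hx hz
  have e2 := cos_angle_of_unit hz hv
  rw [h₁] at e1
  rw [h₂, Real.cos_pi_div_two_sub] at e2
  have : ‖z - (Real.cos a • x + Real.sin a • v)‖ ^ 2 = 0 := by
    rw [norm_sub_sq_real, norm_cos_add_sin hx hv hxv, inner_add_right, inner_smul_right,
      inner_smul_right, real_inner_comm, ← e1, ← e2, hz]
    nlinarith [Real.sin_sq_add_cos_sq a]
  exact sub_eq_zero.1 (norm_eq_zero.1 (pow_eq_zero_iff two_ne_zero |>.1 this))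

/-- The three-dimensional Euclidean space. -/
abbrev EThree : Type := WithLp 2 (ℂ × ℝ)

/-- The point of parameter `t` of the equator of the unit sphere. -/
def equatorVec (t : UnitAddCircle) : EThree := WithLp.toLp 2 (unitCircleMap t, 0)

/-- The north pole of the unit sphere. -/
def poleVec : EThree := WithLp.toLp 2 (0, 1)

theorem norm_equatorVec (t : UnitAddCircle) : ‖equatorVec t‖ = 1 := by
  rw [equatorVec, norm_toLp_prod, norm_unitCircleMap]; simp

theorem norm_poleVec : ‖poleVec‖ = 1 := by
  rw [poleVec, norm_toLp_prod]; simp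

theorem inner_equatorVec_poleVec (t : UnitAddCircle) : inner ℝ (equatorVec t) poleVec = 0 := by
  simp [equatorVec, poleVec, WithLp.prod_inner_apply]

theorem inner_equatorVec (t t' : UnitAddCircle) :
    inner ℝ (equatorVec t) (equatorVec t') = Real.cos (2 * Real.pi * ‖t - t'‖) := by
  rw [← inner_unitCircleMap]
  simp [equatorVec, WithLp.prod_inner_apply]

theorem inner_one_I : inner ℝ (1 : ℂ) Complex.I = 0 := by simp [Complex.inner]

/-- The point of latitude `a` and longitude `t` on the unit sphere. -/
def spherePoint (a : ℝ) (t : UnitAddCircle) : sphere (0 : EThree) 1 :=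
  ⟨Real.cos a • equatorVec t + Real.sin a • poleVec, mem_sphere_zero_iff_norm.2
    (norm_cos_add_sin (norm_equatorVec t) norm_poleVec (inner_equatorVec_poleVec t) a)⟩

/-- The point of angle `a` of the unit circle. -/
def arcPoint (a : ℝ) : sphere (0 : ℂ) 1 :=
  ⟨Real.cos a • (1 : ℂ) + Real.sin a • Complex.I, mem_sphere_zero_iff_norm.2
    (norm_cos_add_sin norm_one Complex.norm_I inner_one_I a)⟩

theorem inner_spherePoint (a : ℝ) (t t' : UnitAddCircle) :
    inner ℝ (spherePoint a t : EThree) (spherePoint a t' : EThree) =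
      Real.cos a ^ 2 * Real.cos (2 * Real.pi * ‖t - t'‖) + Real.sin a ^ 2 := by
  have h1 := inner_equatorVec_poleVec t'
  rw [real_inner_comm] at h1
  simp only [spherePoint, inner_add_left, inner_add_right, inner_smul_left, inner_smul_right,
    inner_equatorVec, inner_equatorVec_poleVec, h1, real_inner_self_eq_norm_sq, norm_poleVec]
  simp; ring

theorem angle_spherePoint_le (a : ℝ) (t t' : UnitAddCircle) :
    angle (spherePoint a t : EThree) (spherePoint a t' : EThree) ≤ 2 * Real.pi * ‖t - t'‖ := by
  have h0 : 0 ≤ 2 * Real.pi * ‖t - t'‖ := by positivity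
  have h1 : 2 * Real.pi * ‖t - t'‖ ≤ Real.pi := by
    nlinarith [norm_unitAddCircle_le (t - t'), Real.pi_pos]
  rw [angle, norm_eq_of_mem_sphere, norm_eq_of_mem_sphere, inner_spherePoint]
  nth_rewrite 2 [← Real.arccos_cos h0 h1]
  refine Real.antitone_arccos ?_
  have h2 := Real.cos_le_one (2 * Real.pi * ‖t - t'‖)
  have h3 := Real.sin_sq_add_cos_sq a
  rw [show Real.sin a ^ 2 = 1 - Real.cos a ^ 2 by linarith]
  rw [mul_one, div_one]
  nlinarith [mul_nonneg (sq_nonneg (Real.sin a)) (sub_nonneg.2 h2)]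

theorem angle_spherePoint_zero (t t' : UnitAddCircle) :
    angle (spherePoint 0 t : EThree) (spherePoint 0 t' : EThree) = 2 * Real.pi * ‖t - t'‖ :=
  angle_eq_of_inner (norm_eq_of_mem_sphere _) (norm_eq_of_mem_sphere _) (by positivity)
    (by nlinarith [norm_unitAddCircle_le (t - t'), Real.pi_pos]) (by rw [inner_spherePoint]; simp)

theorem spherePoint_pi_div_two (t t' : UnitAddCircle) :
    spherePoint (Real.pi / 2) t = spherePoint (Real.pi / 2) t' := by
  ext1; simp [spherePoint]

/-- The distance from the pole to the closed geodesic in the piece of index `i`. -/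
def capLength (i : ℝ≥0) : ℝ := 3 / 8 + i

theorem le_capLength (i : ℝ≥0) : 3 / 8 ≤ capLength i := le_add_of_nonneg_right i.2

theorem capLength_pos (i : ℝ≥0) : 0 < capLength i := by linarith [le_capLength i]

/-- The radius of the circle factor in the piece of index `i`. -/
def capRadius (i : ℝ≥0) : ℝ := 2 / Real.pi * √(capLength i ^ 2 - 1 / 16)

theorem capRadius_pos (i : ℝ≥0) : 0 < capRadius i := by
  have : 0 < capLength i ^ 2 - 1 / 16 := by nlinarith [le_capLength i]
  unfold capRadius
  positivity

theorem sphereRadius_pos : 0 < 1 / (2 * Real.pi) := by positivity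

theorem sq_radii (i : ℝ≥0) :
    (1 / (2 * Real.pi)) ^ 2 + capRadius i ^ 2 = (2 / Real.pi * capLength i) ^ 2 := by
  have : 0 ≤ capLength i ^ 2 - 1 / 16 := by nlinarith [le_capLength i]
  have := Real.pi_ne_zero
  rw [capRadius, mul_pow, Real.sq_sqrt ‹_›]
  field_simp
  ring

/-- The product of a round sphere with equator of length one and a circle. -/
abbrev capSpace (i : ℝ≥0) : ClosedRiemannianManifold :=
  sphereProd 2 1 EThree ℂ one_le_two le_rfl sphereRadius_pos (capRadius_pos i)

/-- The point of `capSpace i` with given coordinates. -/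
def capMk (i : ℝ≥0) (x : sphere (0 : EThree) 1) (y : sphere (0 : ℂ) 1) : capSpace i :=
  sphereProd.mk _ _ _ _ x y

theorem edist_capMk (i : ℝ≥0) (x x' : sphere (0 : EThree) 1) (y y' : sphere (0 : ℂ) 1) :
    edist (capMk i x y) (capMk i x' y') = ENNReal.ofReal
      (√((1 / (2 * Real.pi) * angle (x : EThree) x') ^ 2 + (capRadius i * angle (y : ℂ) y') ^ 2)) :=
  sphereProd.edist_mk _ _ _ _

/-- The point at angle `a` on the geodesic from the point `t` of the closed geodesic to the
pole. -/
def capPoint (i : ℝ≥0) (a : ℝ) (t : UnitAddCircle) : capSpace i :=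
  capMk i (spherePoint a t) (arcPoint a)

/-- The pole of `capSpace i`. -/
def capPole (i : ℝ≥0) : capSpace i := capPoint i (Real.pi / 2) 0

theorem capPoint_pi_div_two (i : ℝ≥0) (t : UnitAddCircle) :
    capPoint i (Real.pi / 2) t = capPole i := by
  rw [capPole, capPoint, capPoint, spherePoint_pi_div_two t 0]

theorem edist_capPoint (i : ℝ≥0) {a b : ℝ} (h : |a - b| ≤ Real.pi) (t : UnitAddCircle) :
    edist (capPoint i a t) (capPoint i b t) =
      ENNReal.ofReal (|a - b| * (2 / Real.pi * capLength i)) := by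
  rw [capPoint, capPoint, edist_capMk]
  have h1 : angle (spherePoint a t : EThree) (spherePoint b t : EThree) = |a - b| :=
    angle_cos_add_sin (norm_equatorVec t) norm_poleVec (inner_equatorVec_poleVec t) h
  have h2 : angle (arcPoint a : ℂ) (arcPoint b : ℂ) = |a - b| :=
    angle_cos_add_sin norm_one Complex.norm_I inner_one_I h
  have h3 := capLength_pos i
  rw [h1, h2, mul_pow, mul_pow, ← add_mul, sq_radii, ← mul_pow, Real.sqrt_sq (by positivity),
    mul_comm]

theorem edist_capPoint_le (i : ℝ≥0) (a : ℝ) (t t' : UnitAddCircle) :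
    edist (capPoint i a t) (capPoint i a t') ≤ edist t t' := by
  rw [capPoint, capPoint, edist_capMk, edist_unitAddCircle]
  refine ENNReal.ofReal_le_ofReal ?_
  have h0 : (arcPoint a : ℂ) ≠ 0 := fun h => by simpa [h] using norm_eq_of_mem_sphere (arcPoint a)
  rw [angle_self h0, mul_zero, zero_pow two_ne_zero, add_zero, Real.sqrt_sq
    (mul_nonneg sphereRadius_pos.le (angle_nonneg _ _))]
  refine (mul_le_mul_of_nonneg_left (angle_spherePoint_le a t t') sphereRadius_pos.le).trans_eq ?_
  field_simp

theorem isometry_capPoint_zero (i : ℝ≥0) : Isometry (capPoint i 0) := by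
  intro t t'
  rw [capPoint, capPoint, edist_capMk, edist_unitAddCircle]
  have h0 : (arcPoint 0 : ℂ) ≠ 0 := fun h => by simpa [h] using norm_eq_of_mem_sphere (arcPoint 0)
  rw [angle_self h0, mul_zero, zero_pow two_ne_zero, add_zero, Real.sqrt_sq
    (mul_nonneg sphereRadius_pos.le (angle_nonneg _ _)), angle_spherePoint_zero]
  congr 1
  field_simp

/-- A point with the right distances to the pole and to a point of the closed geodesic lies on the
geodesic between them. -/
theorem eq_capPoint_of_edist (i : ℝ≥0) (t : UnitAddCircle) (z : capSpace i) {σ τ : ℝ} (hσ : 0 ≤ σ)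
    (hτ : 0 ≤ τ) (hl : σ + τ = capLength i) (h₁ : edist (capPole i) z = ENNReal.ofReal σ)
    (h₂ : edist z (capPoint i 0 t) = ENNReal.ofReal τ) :
    z = capPoint i (τ / capLength i * (Real.pi / 2)) t := by
  obtain ⟨x, y, rfl⟩ := sphereProd.exists_mk z
  change capMk i x y = _
  rw [← capPoint_pi_div_two i t] at h₁
  change edist _ (capMk i x y) = _ at h₁
  change edist (capMk i x y) _ = _ at h₂
  have hL := capLength_pos i
  have hpi := Real.pi_pos
  have hR := capRadius_pos i
  have hr := sphereRadius_pos
  rw [capPoint, edist_capMk, ENNReal.ofReal_eq_ofReal_iff (Real.sqrt_nonneg _) (by assumption),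
    Real.sqrt_eq_iff_eq_sq (by positivity) (by assumption)] at h₁ h₂
  have np : (spherePoint (Real.pi / 2) t : EThree) = poleVec := by simp [spherePoint]
  have ne : (spherePoint 0 t : EThree) = equatorVec t := by simp [spherePoint]
  have ap : (arcPoint (Real.pi / 2) : ℂ) = Complex.I := by simp [arcPoint]
  have ae : (arcPoint 0 : ℂ) = 1 := by simp [arcPoint]
  rw [np, ap] at h₁
  rw [ne, ae] at h₂
  have hx : ‖(x : EThree)‖ = 1 := norm_eq_of_mem_sphere x
  have hy : ‖(y : ℂ)‖ = 1 := norm_eq_of_mem_sphere y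
  have hNA : inner ℝ poleVec (equatorVec t) = 0 := by
    rw [real_inner_comm, inner_equatorVec_poleVec]
  have hI1 : inner ℝ Complex.I (1 : ℂ) = 0 := by rw [real_inner_comm, inner_one_I]
  have t1 : Real.pi / 2 ≤ angle poleVec x + angle (x : EThree) (equatorVec t) :=
    (inner_eq_zero_iff_angle_eq_pi_div_two _ _).1 hNA ▸ angle_le_angle_add_angle _ _ _
  have t2 : Real.pi / 2 ≤ angle Complex.I y + angle (y : ℂ) 1 :=
    (inner_eq_zero_iff_angle_eq_pi_div_two _ _).1 hI1 ▸ angle_le_angle_add_angle _ _ _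
  have huv : (1 / (2 * Real.pi) * (Real.pi / 2)) ^ 2 + (capRadius i * (Real.pi / 2)) ^ 2 =
      (σ + τ) ^ 2 := by
    rw [mul_pow, mul_pow, ← add_mul, sq_radii, hl, ← mul_pow]
    congr 1
    field_simp
  have hA : 1 / (2 * Real.pi) * (Real.pi / 2) ≤
      1 / (2 * Real.pi) * angle poleVec x + 1 / (2 * Real.pi) * angle (x : EThree) (equatorVec t) := by
    rw [← mul_add]; gcongr
  have hB : capRadius i * (Real.pi / 2) ≤
      capRadius i * angle Complex.I y + capRadius i * angle (y : ℂ) 1 := by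
    rw [← mul_add]; gcongr
  obtain ⟨a1, b1⟩ := eq_of_minkowski_eq (by positivity) (by positivity) hσ hτ (hl ▸ hL) huv h₁ h₂ hA hB
  obtain ⟨a2, b2⟩ := eq_of_minkowski_eq (u := 1 / (2 * Real.pi) * (Real.pi / 2))
    (v := capRadius i * (Real.pi / 2)) (by positivity) (by positivity) hτ hσ
    (by rw [add_comm, hl]; exact hL) (by rw [add_comm τ σ]; exact huv) h₂ h₁
    (by rw [add_comm]; exact hA) (by rw [add_comm]; exact hB)
  rw [mul_left_comm] at a1 b1 a2 b2
  have a1' := mul_left_cancel₀ hr.ne' a1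
  have a2' := mul_left_cancel₀ hr.ne' a2
  have b1' := mul_left_cancel₀ hR.ne' b1
  have b2' := mul_left_cancel₀ hR.ne' b2
  rw [hl] at a1' b1'
  rw [add_comm τ σ, hl] at a2' b2'
  have hsum : σ / capLength i * (Real.pi / 2) = Real.pi / 2 - τ / capLength i * (Real.pi / 2) := by
    rw [← hl] at hL ⊢
    field_simp
    ring
  rw [hsum] at a1' b1'
  rw [angle_comm] at a1' b1' a2' b2'
  have ex : x = spherePoint (τ / capLength i * (Real.pi / 2)) t := Subtype.ext
    (eq_cos_add_sin_of_angle (norm_equatorVec t) norm_poleVec hx (inner_equatorVec_poleVec t) a2' a1')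
  have ey : y = arcPoint (τ / capLength i * (Real.pi / 2)) := Subtype.ext
    (eq_cos_add_sin_of_angle norm_one Complex.norm_I hy inner_one_I b2' b1')
  rw [ex, ey, capPoint]

theorem existsUnique_isMinimizingGeodesic_capSpace (i : ℝ≥0) (t : UnitAddCircle) :
    ∃! c : Set.Icc (0 : ℝ) (3 / 8 + i : ℝ≥0) → capSpace i,
      IsMinimizingGeodesic (capPole i) (capPoint i 0 t) c := by
  have hl : ((3 / 8 + i : ℝ≥0) : ℝ) = capLength i := by simp [capLength]
  have hL := capLength_pos i
  have hpi := Real.pi_pos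
  refine ⟨fun σ => capPoint i ((capLength i - σ) / capLength i * (Real.pi / 2)) t, ⟨?_, ?_, ?_⟩, ?_⟩
  · intro σ τ
    have h1 : (capLength i - σ) / capLength i * (Real.pi / 2) -
        (capLength i - τ) / capLength i * (Real.pi / 2) = (τ - σ) / capLength i * (Real.pi / 2) := by
      ring
    have h2 : |(τ : ℝ) - σ| ≤ capLength i := by
      rw [abs_le, ← hl]
      constructor <;> linarith [σ.2.1, σ.2.2, τ.2.1, τ.2.2]
    have h3 : |(τ - σ : ℝ) / capLength i * (Real.pi / 2)| = |(τ : ℝ) - σ| / capLength i * (Real.pi / 2) := by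
      rw [abs_mul, abs_div, abs_of_pos hL, abs_of_pos (by positivity : 0 < Real.pi / 2)]
    change edist (capPoint i _ t) (capPoint i _ t) = _
    rw [edist_capPoint, h1, h3, Subtype.edist_eq, edist_dist, Real.dist_eq, abs_sub_comm]
    · congr 1; field_simp
    · rw [h1, h3]
      have : |(τ : ℝ) - σ| / capLength i ≤ 1 := (div_le_one hL).2 h2
      nlinarith
  · change capPoint i ((capLength i - 0) / capLength i * (Real.pi / 2)) t = _
    rw [sub_zero, div_self hL.ne', one_mul, capPoint_pi_div_two]
  · change capPoint i ((capLength i - (3 / 8 + i : ℝ≥0)) / capLength i * (Real.pi / 2)) t = _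
    rw [hl, sub_self, zero_div, zero_mul]
  · rintro c ⟨hc, h0, h1⟩
    funext σ
    have hσ : 0 ≤ (σ : ℝ) ∧ (σ : ℝ) ≤ capLength i := ⟨σ.2.1, σ.2.2.trans_eq hl⟩
    refine eq_capPoint_of_edist i t (c σ) (σ := σ) (τ := capLength i - σ) hσ.1
      (sub_nonneg.2 hσ.2) (by ring) ?_ ?_
    · rw [← h0, hc, Subtype.edist_eq, edist_dist, Real.dist_eq, zero_sub, abs_neg,
        abs_of_nonneg hσ.1]
    · rw [← h1, hc, Subtype.edist_eq, edist_dist, Real.dist_eq, abs_sub_comm]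
      simp only [hl]
      rw [abs_of_nonneg (sub_nonneg.2 hσ.2)]

theorem edist_capPole (i : ℝ≥0) (t : UnitAddCircle) :
    edist (capPole i) (capPoint i 0 t) = ENNReal.ofReal (capLength i) := by
  rw [← capPoint_pi_div_two i t, edist_capPoint]
  · rw [sub_zero, abs_of_pos (by positivity)]
    congr 1; field_simp
  · rw [sub_zero, abs_of_pos (by positivity)]; linarith [Real.pi_pos]

/-- The projection of the sphere factor to the equatorial plane. -/
def capFst {i : ℝ≥0} (z : capSpace i) : ℂ :=
  ((show sphere (0 : EThree) 1 × sphere (0 : ℂ) 1 from z).1 : EThree).fst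

theorem norm_withLp_fst_le (x : EThree) : ‖x.fst‖ ≤ ‖x‖ := by
  rw [WithLp.prod_norm_eq_of_L2]
  exact Real.le_sqrt_of_sq_le (le_add_of_nonneg_right (sq_nonneg _))

theorem norm_capFst_le {i : ℝ≥0} (z : capSpace i) : ‖capFst z‖ ≤ 1 :=
  (norm_withLp_fst_le (((show sphere (0 : EThree) 1 × sphere (0 : ℂ) 1 from z).1 : EThree))).trans_eq
    (norm_eq_of_mem_sphere _)

theorem realDist_triangle {i : ℝ≥0} (x y z : capSpace i) :
    realDist x z ≤ realDist x y + realDist y z := by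
  rw [realDist, realDist, realDist, ← ENNReal.toReal_add (sphereProd.edist_ne_top _ _)
    (sphereProd.edist_ne_top _ _)]
  exact ENNReal.toReal_mono (ENNReal.add_ne_top.2 ⟨sphereProd.edist_ne_top _ _,
    sphereProd.edist_ne_top _ _⟩) (edist_triangle _ _ _)

theorem norm_capFst_sub_le {i : ℝ≥0} (z w : capSpace i) :
    ‖capFst z - capFst w‖ ≤ 8 * realDist z w := by
  obtain ⟨x, y, rfl⟩ := sphereProd.exists_mk z
  obtain ⟨x', y', rfl⟩ := sphereProd.exists_mk w
  change ‖(x : EThree).fst - (x' : EThree).fst‖ ≤ 8 * realDist (capMk i x y) (capMk i x' y')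
  have h1 : ‖(x : EThree).fst - (x' : EThree).fst‖ ≤ angle (x : EThree) x' :=
    (norm_withLp_fst_le ((x : EThree) - (x' : EThree))).trans
      (norm_sub_le_angle (norm_eq_of_mem_sphere _) (norm_eq_of_mem_sphere _))
  have h2 : 1 / (2 * Real.pi) * angle (x : EThree) x' ≤ realDist (capMk i x y) (capMk i x' y') := by
    rw [realDist, edist_capMk, ENNReal.toReal_ofReal (Real.sqrt_nonneg _)]
    exact Real.le_sqrt_of_sq_le (le_add_of_nonneg_right (sq_nonneg _))
  refine h1.trans ((?_ : _ ≤ 8 * (1 / (2 * Real.pi) * angle (x : EThree) x')).trans (by gcongr))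
  rw [← mul_assoc]
  refine le_mul_of_one_le_left (angle_nonneg _ _) ?_
  rw [mul_one_div, one_le_div (by positivity)]
  linarith [Real.pi_le_four]

theorem realDist_of_capFst_eq_zero {i : ℝ≥0} {z : capSpace i} (h : capFst z = 0)
    (t : UnitAddCircle) : 1 / 4 ≤ realDist z (capPoint i 0 t) := by
  obtain ⟨x, y, rfl⟩ := sphereProd.exists_mk z
  change 1 / 4 ≤ realDist (capMk i x y) (capMk i _ _)
  have h0 : (x : EThree).fst = 0 := h
  have h1 : angle (x : EThree) (spherePoint 0 t : EThree) = Real.pi / 2 := by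
    rw [← inner_eq_zero_iff_angle_eq_pi_div_two]
    simp [spherePoint, equatorVec, WithLp.prod_inner_apply, h0]
  rw [realDist, edist_capMk, ENNReal.toReal_ofReal (Real.sqrt_nonneg _), h1]
  refine Real.le_sqrt_of_sq_le ((?_ : _ = _).trans_le (le_add_of_nonneg_right (sq_nonneg _)))
  field_simp
  norm_num

/-- The cutoff function that vanishes near the pole and is one away from it. -/
def capCutoff {i : ℝ≥0} (z : capSpace i) : ℝ :=
  max 0 (min 1 (4 * realDist z (capPole i) - 1 / 4))

theorem abs_capCutoff_sub_le {i : ℝ≥0} (z w : capSpace i) :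
    |capCutoff z - capCutoff w| ≤ 4 * realDist z w := by
  have h1 : |realDist z (capPole i) - realDist w (capPole i)| ≤ realDist z w := by
    have h2 := realDist_triangle z w (capPole i)
    have h3 := realDist_triangle w z (capPole i)
    have h4 : realDist w z = realDist z w := by rw [realDist, realDist, edist_comm]
    rw [abs_le]
    constructor <;> linarith
  rw [capCutoff, capCutoff, max_comm 0, max_comm 0]
  refine (abs_max_sub_max_le_abs _ _ _).trans ?_
  refine (abs_min_sub_min_le_max _ _ _ _).trans ?_
  rw [sub_self, abs_zero, max_eq_right (abs_nonneg _)]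
  rw [sub_sub_sub_cancel_right, ← mul_sub, abs_mul, abs_of_pos (by norm_num : (0 : ℝ) < 4)]
  gcongr

/-- A Lipschitz extension to `capSpace i` of the parameter of the closed geodesic. -/
def capMap {i : ℝ≥0} (z : capSpace i) : ℂ := 1 + capCutoff z * (capFst z - 1)

theorem lipschitzWith_capMap (i : ℝ≥0) : LipschitzWith 16 (capMap : capSpace i → ℂ) := by
  intro z w
  rw [← ENNReal.ofReal_toReal (sphereProd.edist_ne_top z w), edist_dist, dist_eq_norm,
    show ((16 : ℝ≥0) : ℝ≥0∞) = ENNReal.ofReal 16 by simp, ← ENNReal.ofReal_mul (by norm_num)]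
  refine ENNReal.ofReal_le_ofReal ?_
  change _ ≤ 16 * realDist z w
  have e : capMap z - capMap w = capCutoff z * (capFst z - capFst w) +
      ((capCutoff z - capCutoff w : ℝ) : ℂ) * (capFst w - 1) := by
    simp only [capMap]; push_cast; ring
  have h1 : ‖(capCutoff z : ℂ)‖ ≤ 1 := by
    have h0 : 0 ≤ capCutoff z := le_max_left _ _
    rw [Complex.norm_real, Real.norm_of_nonneg h0]
    exact max_le zero_le_one (min_le_left _ _)
  have h2 : ‖capFst w - 1‖ ≤ 2 := by
    refine (norm_sub_le _ _).trans ?_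
    rw [norm_one]; linarith [norm_capFst_le w]
  have h3 := norm_capFst_sub_le z w
  have h4 := abs_capCutoff_sub_le z w
  have h5 : 0 ≤ realDist z w := ENNReal.toReal_nonneg
  rw [e]
  refine (norm_add_le _ _).trans ?_
  rw [norm_mul, norm_mul, Complex.norm_real (capCutoff z - _), Real.norm_eq_abs]
  calc _ ≤ 1 * (8 * realDist z w) + (4 * realDist z w) * 2 := by gcongr
    _ = _ := by ring

theorem capCutoff_eq_one {i : ℝ≥0} {z : capSpace i} {t : UnitAddCircle}
    (h : realDist z (capPoint i 0 t) ≤ 1 / 16) : capCutoff z = 1 := by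
  have h1 := realDist_triangle (capPole i) z (capPoint i 0 t)
  have h2 : realDist (capPole i) (capPoint i 0 t) = capLength i := by
    rw [realDist, edist_capPole, ENNReal.toReal_ofReal (capLength_pos i).le]
  have h3 : realDist (capPole i) z = realDist z (capPole i) := by rw [realDist, realDist, edist_comm]
  have h4 := le_capLength i
  rw [capCutoff, min_eq_left (by linarith), max_eq_right zero_le_one]

theorem capCutoff_eq_zero {i : ℝ≥0} {z : capSpace i}
    (h : realDist z (capPole i) ≤ 1 / 16) : capCutoff z = 0 := by
  rw [capCutoff, max_eq_left]
  exact (min_le_right _ _).trans (by linarith)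

theorem realDist_self {X : Type*} [EMetricSpace X] (x : X) : realDist x x = 0 := by simp [realDist]

theorem realDist_le_of_edist_le {X : Type*} [EMetricSpace X] {x y : X} (h : edist x y ≤ 1 / 16) :
    realDist x y ≤ 1 / 16 := by
  have := ENNReal.toReal_mono (by simp) h
  simpa [realDist] using this

/-- The pieces of positive index. -/
def capPiece {i : ℝ≥0} (hi : 0 < i) : GluingPiece i where
  M := capSpace i
  γ := capPoint i 0
  p := capPole i
  ψ := capMap
  isometry := isometry_capPoint_zero i
  midpoint := sphereProd.exists_midpoint
  lipschitz := lipschitzWith_capMap i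
  ψ_γ t := by
    rw [capMap, capCutoff_eq_one (t := t) (by rw [realDist_self]; norm_num)]
    change 1 + ((1 : ℝ) : ℂ) * ((spherePoint 0 t : EThree).fst - 1) = _
    simp [spherePoint, equatorVec]
  ψ_p := by rw [capMap, capCutoff_eq_zero (by rw [realDist_self]; norm_num)]; simp
  ψ_ne_zero_of_eq h := (hi.ne' h).elim
  ψ_ne_zero_of_near_γ z t h h0 := by
    have h := realDist_le_of_edist_le h
    rw [capMap, capCutoff_eq_one h] at h0
    have := realDist_of_capFst_eq_zero (z := z) (by simpa using h0) t
    linarith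
  ψ_ne_zero_of_near_p z h := by
    rw [capMap, capCutoff_eq_zero (realDist_le_of_edist_le h)]; simp
  le_edist h := (hi.ne' h).elim
  edist_lt h := (hi.ne' h).elim
  existsUnique_geodesic _ := existsUnique_isMinimizingGeodesic_capSpace i
  homotopy _ := by
    have hpi := Real.pi_pos
    refine ⟨fun s t => capPoint i (s * (Real.pi / 2)) t, fun t => by simp, fun t => ?_,
      fun s hs s' hs' t => ?_, fun s _ t t' => edist_capPoint_le i _ t t'⟩
    · change capPoint i (1 * _) t = _
      rw [one_mul, capPoint_pi_div_two]
    · have h1 : |s * (Real.pi / 2) - s' * (Real.pi / 2)| = |s - s'| * (Real.pi / 2) := by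
        rw [← sub_mul, abs_mul, abs_of_pos (by positivity : 0 < Real.pi / 2)]
      have h2 : |s - s'| ≤ 1 := by
        rw [abs_le]; constructor <;> linarith [hs.1, hs.2, hs'.1, hs'.2]
      rw [edist_capPoint i (by rw [h1]; nlinarith), h1]
      refine ENNReal.ofReal_le_ofReal (le_of_eq ?_)
      rw [capLength]
      field_simp

/-- The pieces of the glued space. -/
def gluingPiece (i : ℝ≥0) : GluingPiece i :=
  if h : i = 0 then h ▸ torusPiece else capPiece (pos_iff_ne_zero.2 h)

end CapPiece

section Menger

variable {X : Type u} [EMetricSpace X]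

/-- `z` lies metrically between `x` and `y`. -/
def MetricBetween (x z y : X) : Prop := edist x z + edist z y = edist x y

theorem metricBetween_of_le {x z y : X} (h : edist x z + edist z y ≤ edist x y) :
    MetricBetween x z y := le_antisymm h (edist_triangle _ _ _)

theorem MetricBetween.trans_left {x z w y : X} (hw : MetricBetween x w y) (hz : MetricBetween x z w) :
    MetricBetween x z y := by
  refine metricBetween_of_le ?_
  rw [← hw, ← hz, add_assoc]
  exact add_le_add le_rfl (edist_triangle _ _ _)

theorem MetricBetween.trans_right {x z w y : X} (hw : MetricBetween x w y)
    (hz : MetricBetween w z y) : MetricBetween x z y := by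
  refine metricBetween_of_le ?_
  rw [← hw, ← hz, ← add_assoc]
  exact add_le_add (edist_triangle _ _ _) le_rfl

/-- If `w` is between `x` and `y`, and `z` between `w` and `y`, then `w` is between `x` and `z`. -/
theorem MetricBetween.of_trans_right {x z w y : X} (hw : MetricBetween x w y)
    (hz : MetricBetween w z y) (hfin : edist x y ≠ ⊤) : MetricBetween x w z := by
  refine metricBetween_of_le ?_
  have h1 : edist z y ≠ ⊤ := ne_top_of_le_ne_top hfin (by
    rw [← hw, ← hz, ← add_assoc]; exact le_add_self)
  refine (ENNReal.add_le_add_iff_right h1).1 ?_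
  rw [add_assoc, hz, hw]
  exact edist_triangle _ _ _

/-- In a complete convex metric space, points at finite distance are joined by a geodesic. -/
theorem IsConvexMetric.exists_geodesic [CompleteSpace X] (hX : IsConvexMetric X) (x y : X)
    (hfin : edist x y ≠ ⊤) : ∃ c : Set.Icc (0 : ℝ) (edist x y).toReal → X,
      Isometry c ∧ c ⟨0, le_rfl, ENNReal.toReal_nonneg⟩ = x ∧
        c ⟨(edist x y).toReal, ENNReal.toReal_nonneg, le_rfl⟩ = y := by
  have hxy : MetricBetween x y y := by simp [MetricBetween]
  let S : Set X := {z | MetricBetween x z y}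
  -- a maximal chain of points between `x` and `y`
  let r' : S → S → Prop := fun z w => MetricBetween x z.1 w.1
  obtain ⟨C, hC⟩ : ∃ C, IsMaxChain r' C := ⟨_, maxChain_spec⟩
  let ρ : X → ℝ := fun z => (edist x z).toReal
  have hfx : ∀ z : S, edist x z.1 ≠ ⊤ := fun z => ne_top_of_le_ne_top hfin (by
    rw [← z.2]; exact le_self_add)
  have hcmp : ∀ z ∈ C, ∀ w ∈ C, r' z w ∨ r' w z := fun z hz w hw => by
    by_cases h : z = w
    · subst h; left; simp [r', MetricBetween]
    · exact hC.1 hz hw h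
  have hmem : ∀ z : S, (∀ w ∈ C, r' z w ∨ r' w z) → z ∈ C := fun z hz => by
    have h1 : IsChain r' (insert z C) := hC.1.insert fun w hw _ => hz w hw
    rw [hC.2 h1 (Set.subset_insert _ _)]
    exact Set.mem_insert _ _
  have hdist : ∀ z w : S, r' z w → edist z.1 w.1 = ENNReal.ofReal (ρ w - ρ z) := fun z w h => by
    have h1 : edist z.1 w.1 ≠ ⊤ := ne_top_of_le_ne_top (hfx w) (by rw [← h]; exact le_add_self)
    have h2 : ρ w = ρ z + (edist z.1 w.1).toReal := by
      simp only [ρ]; rw [← ENNReal.toReal_add (hfx z) h1, h]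
    rw [h2, add_sub_cancel_left, ENNReal.ofReal_toReal h1]
  have hle : ∀ z w : S, r' z w → ρ z ≤ ρ w := fun z w h =>
    ENNReal.toReal_mono (hfx w) (by rw [← h]; exact le_self_add)
  have hiso : ∀ z ∈ C, ∀ w ∈ C, edist z.1 w.1 = edist (ρ z.1) (ρ w.1) := fun z hz w hw => by
    rcases hcmp z hz w hw with h | h
    · rw [hdist z w h, edist_dist, Real.dist_eq, abs_sub_comm, abs_of_nonneg (sub_nonneg.2 (hle _ _ h))]
    · rw [edist_comm, hdist w z h, edist_dist, Real.dist_eq, abs_of_nonneg (sub_nonneg.2 (hle _ _ h))]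
  have hxC : (⟨x, by simp [S, MetricBetween]⟩ : S) ∈ C :=
    hmem _ fun w _ => Or.inl (by simp [r', MetricBetween])
  have hyC : (⟨y, hxy⟩ : S) ∈ C := hmem _ fun w _ => Or.inr w.2
  have hord : ∀ z ∈ C, ∀ w ∈ C, ρ z.1 ≤ ρ w.1 → r' z w := fun z hz w hw h => by
    rcases hcmp z hz w hw with h1 | h1
    · exact h1
    · have h2 := hdist w z h1
      rw [ENNReal.ofReal_of_nonpos (sub_nonpos.2 h)] at h2
      rw [Subtype.ext (eq_of_edist_eq_zero h2)]
      simp [r', MetricBetween]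
  let C' : Set X := Subtype.val '' C
  have hclS : ∀ w : X, IsClosed {z : X | MetricBetween x z w} := fun w =>
    isClosed_eq ((continuous_const.edist continuous_id).add (continuous_id.edist continuous_const))
      continuous_const
  have hclS' : ∀ w : X, IsClosed {z : X | MetricBetween x w z} := fun w =>
    isClosed_eq (continuous_const.add (continuous_const.edist continuous_id))
      (continuous_const.edist continuous_id)
  have hcl : IsClosed C' := by
    refine isClosed_of_closure_subset fun z hz => ?_
    have h1 : z ∈ S := (hclS y).closure_subset_iff.2 (by rintro _ ⟨w, _, rfl⟩; exact w.2) hz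
    refine ⟨⟨z, h1⟩, hmem _ fun w hw => ?_, rfl⟩
    exact ((hclS w.1).union (hclS' w.1)).closure_subset_iff.2
      (by rintro _ ⟨v, hv, rfl⟩; exact hcmp v hv w hw) hz
  have : CompleteSpace C' := hcl.completeSpace_coe
  let f : C' → ℝ := fun z => ρ z
  have hf : Isometry f := by
    rintro ⟨_, z, hz, rfl⟩ ⟨_, w, hw, rfl⟩
    exact (hiso z hz w hw).symm
  have hK : IsClosed (Set.range f) := hf.isClosedEmbedding.isClosed_range
  have hKC : ∀ t, t ∈ Set.range f ↔ ∃ z ∈ C, ρ z.1 = t := fun t => by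
    constructor
    · rintro ⟨⟨_, z, hz, rfl⟩, rfl⟩
      exact ⟨z, hz, rfl⟩
    · rintro ⟨z, hz, rfl⟩
      exact ⟨⟨z, z, hz, rfl⟩, rfl⟩
  have h0K : (0 : ℝ) ∈ Set.range f := (hKC 0).2 ⟨_, hxC, by simp [ρ]⟩
  have hlK : (edist x y).toReal ∈ Set.range f := (hKC _).2 ⟨_, hyC, rfl⟩
  have hsurj : ∀ t ∈ Set.Icc (0 : ℝ) (edist x y).toReal, ∃ z ∈ C, ρ z.1 = t := by
    intro t ht
    rw [← hKC]
    by_contra htK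
    have hA : IsClosed (Set.range f ∩ Set.Iic t) := hK.inter isClosed_Iic
    have hB : IsClosed (Set.range f ∩ Set.Ici t) := hK.inter isClosed_Ici
    have hAb : BddAbove (Set.range f ∩ Set.Iic t) := ⟨t, fun _ h => h.2⟩
    have hBb : BddBelow (Set.range f ∩ Set.Ici t) := ⟨t, fun _ h => h.2⟩
    obtain ⟨haK, hat⟩ := hA.csSup_mem ⟨0, h0K, ht.1⟩ hAb
    obtain ⟨hbK, hbt⟩ := hB.csInf_mem ⟨_, hlK, ht.2⟩ hBb
    have hgap : ∀ u ∈ C, ρ u.1 ≤ sSup (Set.range f ∩ Set.Iic t) ∨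
        sInf (Set.range f ∩ Set.Ici t) ≤ ρ u.1 := fun u hu => by
      have huK := (hKC _).2 ⟨u, hu, rfl⟩
      rcases le_total (ρ u.1) t with h | h
      · exact Or.inl (le_csSup hAb ⟨huK, h⟩)
      · exact Or.inr (csInf_le hBb ⟨huK, h⟩)
    generalize sSup (Set.range f ∩ Set.Iic t) = a at *
    generalize sInf (Set.range f ∩ Set.Ici t) = b at *
    have hat' : a < t := lt_of_le_of_ne hat fun h => htK (h ▸ haK)
    have hbt' : t < b := lt_of_le_of_ne hbt fun h => htK (h ▸ hbK)
    obtain ⟨z, hz, rfl⟩ := (hKC a).1 haK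
    obtain ⟨w, hw, rfl⟩ := (hKC b).1 hbK
    have hzw : r' z w := hord z hz w hw (hat.trans hbt)
    have hne : z.1 ≠ w.1 := fun h => by rw [h] at hat'; linarith
    have hzwfin : edist z.1 w.1 ≠ ⊤ := by rw [hdist z w hzw]; exact ENNReal.ofReal_ne_top
    obtain ⟨v, hvz, hvw, hv⟩ := hX z.1 w.1 hne hzwfin
    have b1 : MetricBetween z.1 v w.1 := hv.symm
    have b2 : MetricBetween x v w.1 := MetricBetween.trans_right hzw b1
    have b3 : MetricBetween x v y := MetricBetween.trans_left w.2 b2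
    have b4 : MetricBetween x z.1 v := MetricBetween.of_trans_right hzw b1 (hfx w)
    have hvC : (⟨v, b3⟩ : S) ∈ C := hmem _ fun u hu => by
      rcases hgap u hu with h | h
      · exact Or.inr (MetricBetween.trans_left b4 (hord u hu z hz h))
      · exact Or.inl (MetricBetween.trans_left (hord w hw u hu h) b2)
    have d1 := hdist z ⟨v, b3⟩ b4
    have d2 := hdist ⟨v, b3⟩ w b2
    rcases hgap _ hvC with h | h
    · rw [ENNReal.ofReal_of_nonpos (sub_nonpos.2 h)] at d1
      exact hvz (eq_of_edist_eq_zero d1).symm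
    · rw [ENNReal.ofReal_of_nonpos (sub_nonpos.2 h)] at d2
      exact hvw (eq_of_edist_eq_zero d2)
  have : Nonempty S := ⟨⟨y, hxy⟩⟩
  choose! c hcC hcρ using hsurj
  refine ⟨fun t => (c t).1, fun s t => ?_, ?_, ?_⟩
  · rw [hiso _ (hcC s s.2) _ (hcC t t.2), hcρ s s.2, hcρ t t.2]; rfl
  · refine (eq_of_edist_eq_zero (Eq.trans (hiso _ hxC _ (hcC 0 ⟨le_rfl, ENNReal.toReal_nonneg⟩)) ?_)).symm
    rw [hcρ 0 ⟨le_rfl, ENNReal.toReal_nonneg⟩]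
    simp [ρ]
  · refine eq_of_edist_eq_zero ((hiso _ (hcC _ ⟨ENNReal.toReal_nonneg, le_rfl⟩) _ hyC).trans ?_)
    rw [hcρ _ ⟨ENNReal.toReal_nonneg, le_rfl⟩]
    exact edist_self _

end Menger

section Winding

/-- A continuous logarithm of the constant function `1` on a connected space is constant. -/
theorem eq_of_exp_eq_one {X : Type*} [TopologicalSpace X] [PreconnectedSpace X] {φ : X → ℂ}
    (hφ : Continuous φ) (h : ∀ x, Complex.exp (φ x) = 1) (x y : X) : φ x = φ y := by
  choose n hn using fun x => Complex.exp_eq_one_iff.1 (h x)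
  have h1 : ∀ x, (n x : ℝ) = (φ x / (2 * Real.pi * Complex.I)).re := fun x => by
    rw [hn x, mul_div_cancel_right₀ _ Complex.two_pi_I_ne_zero]; simp
  have h2 : Continuous n := by
    rw [Int.isClosedEmbedding_coe_real.isInducing.continuous_iff]
    have : ((↑) : ℤ → ℝ) ∘ n = fun x => (φ x / (2 * Real.pi * Complex.I)).re := funext h1
    rw [this]
    fun_prop
  rw [hn x, hn y, PreconnectedSpace.constant ‹_› h2]

/-- There is no homotopy in the punctured plane from the unit circle to a constant. -/
theorem not_exists_homotopy_unitCircleMap {a b : ℝ} (hab : a ≤ b)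
    (H : Set.Icc a b × UnitAddCircle → ℂ) (hH : Continuous H) (h0 : ∀ p, H p ≠ 0)
    (ha : ∀ t, H (⟨a, le_rfl, hab⟩, t) = unitCircleMap t) (w : ℂ)
    (hb : ∀ t, H (⟨b, hab, le_rfl⟩, t) = w) : False := by
  let G : ℝ × ℝ → ℂ := fun p => H (Set.projIcc a b hab p.1, (p.2 : UnitAddCircle))
  have hG : Continuous G := hH.comp
    ((continuous_projIcc.comp continuous_fst).prodMk
      ((AddCircle.continuous_mk' (1 : ℝ)).comp continuous_snd))
  have huniv : IsSimplyConnected (Set.univ : Set (ℝ × ℝ)) := by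
    have : ContractibleSpace (Set.univ : Set (ℝ × ℝ)) :=
      convex_univ.contractibleSpace Set.univ_nonempty
    exact SimplyConnectedSpace.ofContractible _
  obtain ⟨F, hF, hFG⟩ := Complex.exists_continuousOn_eqOn_exp_comp (X := ℝ × ℝ) (U := Set.univ) (g := G)
    huniv isOpen_univ hG.continuousOn (by rintro ⟨p, -, hp⟩; exact h0 _ hp)
  rw [continuousOn_univ] at hF
  have hexp : ∀ p, Complex.exp (F p) = G p := fun p => hFG (Set.mem_univ p)
  have hdiff : ∀ p q : ℝ × ℝ, F (p.1, p.2 + 1) - F p = F (q.1, q.2 + 1) - F q :=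
    eq_of_exp_eq_one (φ := fun p : ℝ × ℝ => F (p.1, p.2 + 1) - F p) (by fun_prop) fun p => by
      have : G (p.1, p.2 + 1) = G p := by simp [G]
      rw [Complex.exp_sub, hexp, hexp, this, div_self (h0 _)]
  have hB : F (b, 1) = F (b, 0) := by
    have := eq_of_exp_eq_one (φ := fun x : ℝ => F (b, x) - F (b, 0)) (by fun_prop) (fun x => by
      have e : ∀ x, G (b, x) = w := fun x => by
        simp only [G, Set.projIcc_right]; exact hb _
      rw [Complex.exp_sub, hexp, hexp, e, ← e 0, div_self (h0 _)]) 1 0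
    simpa [sub_eq_zero] using this
  have hA : F (a, 1) - 2 * Real.pi * Complex.I = F (a, 0) := by
    have := eq_of_exp_eq_one (φ := fun x : ℝ => F (a, x) - 2 * Real.pi * x * Complex.I)
      (by fun_prop) (fun x => by
      have e : G (a, x) = Complex.exp (2 * Real.pi * x * Complex.I) := by
        simp only [G, Set.projIcc_left]; rw [← unitCircleMap_coe]; exact ha _
      rw [Complex.exp_sub, hexp, e, div_self (Complex.exp_ne_zero _)]) 1 0
    simpa using this
  have h1 := hdiff (a, 0) (b, 0)
  simp only [zero_add, hB, sub_self, ← hA] at h1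
  exact Complex.two_pi_I_ne_zero (by linear_combination h1)

end Winding

section GlueMetric

variable {ι : Type u} {Y : Type v} {X : ι → Type u} [∀ i, EMetricSpace (X i)]

theorem sigmaEDist_mk (i : ι) (x y : X i) : sigmaEDist ⟨i, x⟩ ⟨i, y⟩ = edist x y := by
  simp [sigmaEDist]

theorem sigmaEDist_of_ne {i k : ι} (h : i ≠ k) (x : X i) (y : X k) :
    sigmaEDist ⟨i, x⟩ ⟨k, y⟩ = ⊤ := by
  simp [sigmaEDist, h]

/-- The distance of a gluing in which the distances along the glued set are smallest in the
piece `o`. -/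
def glueEDist (j : ∀ i, Y → X i) (o : ι) (x y : Σ i, X i) : ℝ≥0∞ :=
  min (sigmaEDist x y)
    (⨅ a, ⨅ b, edist x.2 (j x.1 a) + edist (j o a) (j o b) + edist (j y.1 b) y.2)

theorem glueEDist_le (j : ∀ i, Y → X i) (o : ι) (x y : Σ i, X i) (a b : Y) :
    glueEDist j o x y ≤
      edist x.2 (j x.1 a) + edist (j o a) (j o b) + edist (j y.1 b) y.2 :=
  (min_le_right _ _).trans ((iInf_le _ a).trans (iInf_le _ b))

theorem glueEDist_glued (j : ∀ i, Y → X i) (o : ι)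
    (ho : ∀ i a b, edist (j o a) (j o b) ≤ edist (j i a) (j i b)) (i : ι) (a : Y)
    (y : Σ i, X i) :
    glueEDist j o ⟨i, j i a⟩ y = ⨅ b, edist (j o a) (j o b) + edist (j y.1 b) y.2 := by
  apply le_antisymm
  · refine le_iInf fun b => (glueEDist_le j o _ y a b).trans ?_
    simp
  · refine le_min ?_ (le_iInf₂ fun a' b => ?_)
    · obtain ⟨k, y⟩ := y
      by_cases h : i = k
      · subst h
        rw [sigmaEDist_mk]
        exact (iInf_le _ a).trans (by simp)
      · rw [sigmaEDist_of_ne h]; exact le_top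
    · refine (iInf_le _ b).trans ?_
      gcongr
      exact (edist_triangle _ (j o a') _).trans (add_le_add_left (ho i a a') _)

theorem glueEDist_congr (j : ∀ i, Y → X i) (o : ι)
    (ho : ∀ i a b, edist (j o a) (j o b) ≤ edist (j i a) (j i b)) {p q : Σ i, X i}
    (h : glueRel j p q) (y : Σ i, X i) : glueEDist j o p y = glueEDist j o q y := by
  induction h with
  | rel p q h =>
    obtain ⟨a, i, k, rfl, rfl⟩ := h
    rw [glueEDist_glued j o ho, glueEDist_glued j o ho]
  | refl => rfl
  | symm _ _ _ ih => exact ih.symm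
  | trans _ _ _ _ _ ih ih' => exact ih.trans ih'

theorem glueEDist_triangle (j : ∀ i, Y → X i) (o : ι) (x q y : Σ i, X i) :
    glueEDist j o x y ≤ sigmaEDist x q + glueEDist j o q y := by
  obtain ⟨i, x⟩ := x
  obtain ⟨k, q⟩ := q
  by_cases h : i = k
  · subst h
    rw [sigmaEDist_mk]
    have : edist x q + glueEDist j o ⟨i, q⟩ y = min (edist x q + sigmaEDist ⟨i, q⟩ y)
        (edist x q + ⨅ a, ⨅ b, edist q (j i a) + edist (j o a) (j o b) + edist (j y.1 b) y.2) :=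
      (monotone_id.const_add _).map_min
    rw [this]
    refine le_min ?_ ?_
    · refine (min_le_left _ _).trans ?_
      obtain ⟨l, y⟩ := y
      by_cases hl : i = l
      · subst hl
        rw [sigmaEDist_mk, sigmaEDist_mk]
        exact edist_triangle _ _ _
      · rw [sigmaEDist_of_ne hl, sigmaEDist_of_ne hl, add_top]
    · simp only [ENNReal.add_iInf]
      refine le_iInf₂ fun a b => (glueEDist_le j o _ y a b).trans ?_
      rw [← add_assoc, ← add_assoc]
      gcongr
      exact edist_triangle _ _ _
  · rw [sigmaEDist_of_ne h, top_add]; exact le_top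

theorem glueRel_glued {ι : Type u} {Y : Type v} {X : ι → Type u} (j : ∀ i, Y → X i) (i k : ι) (a : Y) :
    glueRel j ⟨i, j i a⟩ ⟨k, j k a⟩ :=
  .rel _ _ ⟨a, i, k, rfl, rfl⟩

theorem chainDist_eq_glueEDist (j : ∀ i, Y → X i) (o : ι)
    (ho : ∀ i a b, edist (j o a) (j o b) ≤ edist (j i a) (j i b)) (x y : Σ i, X i) :
    chainDist (glueRel j) sigmaEDist x y = glueEDist j o x y := by
  apply le_antisymm
  · refine le_min (sInf_le (.single x y)) (le_iInf₂ fun a b => sInf_le ?_)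
    have h := ChainSum.cons (d := sigmaEDist) x _ _ y _ (glueRel_glued j x.1 o a)
      (ChainSum.cons _ _ _ y _ (glueRel_glued j o y.1 b) (.single _ y))
    have e : sigmaEDist x ⟨x.1, j x.1 a⟩ + (sigmaEDist ⟨o, j o a⟩ ⟨o, j o b⟩ +
        sigmaEDist ⟨y.1, j y.1 b⟩ y) =
        edist x.2 (j x.1 a) + edist (j o a) (j o b) + edist (j y.1 b) y.2 := by
      obtain ⟨i, x⟩ := x
      obtain ⟨k, y⟩ := y
      simp only [sigmaEDist_mk, add_assoc]
    rwa [e] at h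
  · refine le_sInf fun s hs => ?_
    induction hs with
    | single x y => exact min_le_left _ _
    | cons x q p y s hqp _ ih =>
      refine (glueEDist_triangle j o x q y).trans ?_
      rw [glueEDist_congr j o ho hqp]
      gcongr

namespace Glue

theorem exists_incl (j : ∀ i, Y → X i) (z : Glue j) : ∃ i x, incl j i x = z := by
  obtain ⟨⟨⟨i, x⟩⟩, rfl⟩ := SeparationQuotient.surjective_mk z
  exact ⟨i, x, rfl⟩

theorem edist_incl_eq_chainDist (j : ∀ i, Y → X i) {i k : ι} (x : X i) (y : X k) :
    edist (incl j i x) (incl j k y) = chainDist (glueRel j) sigmaEDist ⟨i, x⟩ ⟨k, y⟩ :=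
  SeparationQuotient.edist_mk _ _

theorem edist_incl_le (j : ∀ i, Y → X i) {i : ι} (x y : X i) :
    edist (incl j i x) (incl j i y) ≤ edist x y := by
  rw [edist_incl_eq_chainDist]
  have h := ChainSum.single (r := glueRel j) (d := sigmaEDist) ⟨i, x⟩ ⟨i, y⟩
  rw [sigmaEDist_mk] at h
  exact sInf_le h

theorem continuous_incl (j : ∀ i, Y → X i) (i : ι) : Continuous (incl j i) :=
  (LipschitzWith.of_edist_le (edist_incl_le j)).continuous

theorem incl_glued (j : ∀ i, Y → X i) (i k : ι) (a : Y) :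
    incl j i (j i a) = incl j k (j k a) := by
  apply eq_of_edist_eq_zero
  rw [edist_incl_eq_chainDist, ← nonpos_iff_eq_zero]
  refine sInf_le ?_
  have h := ChainSum.cons (d := sigmaEDist) ⟨i, j i a⟩ _ _ _ _ (glueRel_glued j i k a)
    (.single _ ⟨k, j k a⟩)
  rwa [sigmaEDist_self, sigmaEDist_self, add_zero] at h

variable {j : ∀ i, Y → X i} {o : ι}

theorem edist_incl_glued
    (ho : ∀ i a b, edist (j o a) (j o b) ≤ edist (j i a) (j i b))
    (i k : ι) (a b : Y) :
    edist (incl j i (j i a)) (incl j k (j k b)) = edist (j o a) (j o b) := by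
  rw [incl_glued j i o a, incl_glued j k o b]
  refine le_antisymm (edist_incl_le j _ _) ?_
  rw [edist_incl_eq_chainDist, chainDist_eq_glueEDist j o ho, glueEDist_glued j o ho]
  exact le_iInf fun c => edist_triangle _ _ _

theorem exists_edist_incl [TopologicalSpace Y] [CompactSpace Y] [Nonempty Y]
    (ho : ∀ i a b, edist (j o a) (j o b) ≤ edist (j i a) (j i b))
    (hj : ∀ i, Continuous (j i)) {i k : ι} (x : X i) (y : X k) :
    (∃ h : i = k, edist (incl j i x) (incl j k y) = edist (h ▸ x) y) ∨
      ∃ a b, edist (incl j i x) (incl j k y) =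
        edist x (j i a) + edist (j o a) (j o b) + edist (j k b) y := by
  have hc : Continuous fun c : Y × Y =>
      edist x (j i c.1) + edist (j o c.1) (j o c.2) + edist (j k c.2) y := by
    have := hj i; have := hj o; have := hj k
    refine ((Continuous.edist (by fun_prop) (by fun_prop)).add
      (Continuous.edist (by fun_prop) (by fun_prop))).add
      (Continuous.edist (by fun_prop) (by fun_prop))
  obtain ⟨c, -, hmin⟩ := isCompact_univ.exists_isMinOn Set.univ_nonempty hc.continuousOn
  rw [edist_incl_eq_chainDist, chainDist_eq_glueEDist j o ho]
  rcases min_choice (sigmaEDist ⟨i, x⟩ ⟨k, y⟩)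
    (⨅ a, ⨅ b, edist x (j i a) + edist (j o a) (j o b) + edist (j k b) y) with h | h
  · by_cases hik : i = k
    · subst hik
      rw [sigmaEDist_mk] at h
      exact .inl ⟨rfl, by unfold glueEDist; rw [sigmaEDist_mk]; exact h⟩
    · refine .inr ⟨c.1, c.2, le_antisymm (glueEDist_le j o _ _ _ _) ?_⟩
      unfold glueEDist
      rw [h, sigmaEDist_of_ne hik]
      exact le_top
  · refine .inr ⟨c.1, c.2, le_antisymm (glueEDist_le j o _ _ _ _) ?_⟩
    unfold glueEDist
    rw [h]
    exact le_iInf₂ fun a b => hmin (Set.mem_univ (a, b))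

theorem exists_edist_glued_incl [TopologicalSpace Y] [CompactSpace Y] [Nonempty Y]
    (ho : ∀ i a b, edist (j o a) (j o b) ≤ edist (j i a) (j i b))
    (hj : ∀ i, Continuous (j i)) (i : ι) {k : ι} (a : Y) (y : X k) :
    ∃ b, edist (incl j i (j i a)) (incl j k y) = edist (j o a) (j o b) + edist (j k b) y := by
  rw [incl_glued j i k a]
  rcases exists_edist_incl ho hj (j k a) y with ⟨_, h⟩ | ⟨c, b, h⟩
  · exact ⟨a, by simpa using h⟩
  · refine ⟨b, le_antisymm ?_ ?_⟩
    · calc _ ≤ edist (incl j k (j k a)) (incl j k (j k b)) +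
            edist (incl j k (j k b)) (incl j k y) := edist_triangle _ _ _
        _ ≤ _ := by
          rw [edist_incl_glued ho]
          gcongr
          exact edist_incl_le j _ _
    · rw [h]
      gcongr
      exact (edist_triangle _ (j o c) _).trans (add_le_add_left (ho k a c) _)

/-- Compatible Lipschitz functions on the pieces descend to the glued space. -/
theorem exists_lipschitz_extension [TopologicalSpace Y] [CompactSpace Y] [Nonempty Y]
    (ho : ∀ i a b, edist (j o a) (j o b) ≤ edist (j i a) (j i b))
    (hj : ∀ i, Continuous (j i)) {E : Type*} [EMetricSpace E] {K : ℝ≥0} (ψ : ∀ i, X i → E)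
    (hψ : ∀ i, LipschitzWith K (ψ i)) (hψj : ∀ i k a, ψ i (j i a) = ψ k (j k a)) :
    ∃ Ψ : Glue j → E, LipschitzWith K Ψ ∧ ∀ i x, Ψ (incl j i x) = ψ i x := by
  have key : ∀ i k x y, edist (ψ i x) (ψ k y) ≤ K * edist (incl j i x) (incl j k y) := by
    intro i k x y
    rcases exists_edist_incl ho hj x y with ⟨rfl, h⟩ | ⟨a, b, h⟩
    · rw [h]
      exact hψ i x y
    · rw [h, mul_add, mul_add]
      calc _ ≤ edist (ψ i x) (ψ i (j i a)) + edist (ψ i (j i a)) (ψ k (j k b)) +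
            edist (ψ k (j k b)) (ψ k y) := edist_triangle4 _ _ _ _
        _ ≤ _ := by
          rw [hψj i o a, hψj k o b, ← hψj i o a]
          refine add_le_add (add_le_add (hψ i _ _) ?_) ?_
          · rw [hψj i o a]; exact hψ o _ _
          · rw [← hψj k o b]; exact hψ k _ _
  refine ⟨SeparationQuotient.lift (fun q : PreGlue j => ψ q.point.1 q.point.2) ?_, ?_, ?_⟩
  · intro p q hpq
    apply eq_of_edist_eq_zero
    rw [← nonpos_iff_eq_zero]
    refine (key _ _ _ _).trans ?_
    have : incl j p.point.1 p.point.2 = incl j q.point.1 q.point.2 :=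
      SeparationQuotient.mk_eq_mk.2 hpq
    rw [this, edist_self, mul_zero]
  · intro z w
    obtain ⟨i, x, rfl⟩ := exists_incl j z
    obtain ⟨k, y, rfl⟩ := exists_incl j w
    exact key i k x y
  · intro i x
    rfl

end Glue

end GlueMetric

section GlueComplete
open Filter Topology

/-- A point strictly between `p` and `q` is between `u` and `v` if the segment `p q` lies on a
shortest path from `u` to `v`. -/
theorem exists_between_of_midpoint {Z : Type*} [EMetricSpace Z] {u v p q z : Z}
    (huv : edist u v ≠ ⊤) (hpq : p ≠ q)
    (h : edist u v = edist u p + edist p q + edist q v)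
    (hz : edist p z = edist p q / 2) (hz' : edist z q = edist p q / 2) :
    z ≠ u ∧ z ≠ v ∧ edist u v = edist u z + edist z v := by
  have h0 : edist p q ≠ 0 := edist_eq_zero.not.2 hpq
  have hsplit : edist u v = (edist u p + edist p z) + (edist z q + edist q v) := by
    rw [h, hz, hz', add_assoc, add_assoc, ← add_assoc (_ / 2), ENNReal.add_halves]
  have h1 := edist_triangle u p z
  have h2 := edist_triangle z q v
  have h3 := edist_triangle u z v
  have hpos : edist p q / 2 ≠ 0 := by simpa using h0
  have heq : edist u v = edist u z + edist z v :=
    le_antisymm h3 (hsplit ▸ add_le_add h1 h2)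
  have hfin : edist u z ≠ ⊤ ∧ edist z v ≠ ⊤ := by
    rw [heq, ENNReal.add_ne_top] at huv; exact huv
  have hs1 : edist u p + edist p z ≠ ⊤ ∧ edist z q + edist q v ≠ ⊤ := by
    rw [hsplit, ENNReal.add_ne_top] at huv; exact huv
  have e1 : edist u z = edist u p + edist p z := by
    refine le_antisymm h1 ?_
    have : (edist u p + edist p z) + (edist z q + edist q v) ≤
      edist u z + (edist z q + edist q v) := by
      rw [← hsplit, heq]; gcongr
    exact (ENNReal.add_le_add_iff_right hs1.2).1 this
  have e2 : edist z v = edist z q + edist q v := by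
    refine le_antisymm h2 ?_
    have : (edist u p + edist p z) + (edist z q + edist q v) ≤
      (edist u p + edist p z) + edist z v := by
      rw [← hsplit, heq]; gcongr
    exact (ENNReal.add_le_add_iff_left hs1.1).1 this
  refine ⟨?_, ?_, heq⟩
  · rintro rfl
    rw [edist_self, hz] at e1
    exact hpos (add_eq_zero.1 e1.symm).2
  · rintro rfl
    rw [edist_self, hz'] at e2
    exact hpos (add_eq_zero.1 e2.symm).1

variable {ι : Type u} {Y : Type v} {X : ι → Type u} [∀ i, EMetricSpace (X i)]
  {j : ∀ i, Y → X i} {o : ι} [TopologicalSpace Y] [CompactSpace Y] [Nonempty Y]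

namespace Glue

theorem isConvexMetric
    (ho : ∀ i a b, edist (j o a) (j o b) ≤ edist (j i a) (j i b))
    (hj : ∀ i, Continuous (j i))
    (hmid : ∀ i (x y : X i), ∃ z, edist x z = edist x y / 2 ∧ edist z y = edist x y / 2) :
    IsConvexMetric (Glue j) := by
  intro u v huv hfin
  suffices ∃ p q : Glue j, p ≠ q ∧ edist u v = edist u p + edist p q + edist q v ∧
      ∃ i x y, incl j i x = p ∧ incl j i y = q ∧ edist x y = edist p q by
    obtain ⟨_, _, hpq, h, i, x, y, rfl, rfl, hxy⟩ := this
    obtain ⟨z, hz, hz'⟩ := hmid i x y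
    have h1 : edist (incl j i x) (incl j i z) ≤ edist (incl j i x) (incl j i y) / 2 :=
      (edist_incl_le j _ _).trans (by rw [hz, hxy])
    have h2 : edist (incl j i z) (incl j i y) ≤ edist (incl j i x) (incl j i y) / 2 :=
      (edist_incl_le j _ _).trans (by rw [hz', hxy])
    have h3 := edist_triangle (incl j i x) (incl j i z) (incl j i y)
    have hf : edist (incl j i x) (incl j i y) / 2 ≠ ⊤ := by
      rw [h, ENNReal.add_ne_top, ENNReal.add_ne_top] at hfin
      exact ENNReal.div_ne_top hfin.1.2 two_ne_zero
    generalize hD : edist (incl j i x) (incl j i y) / 2 = D at *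
    have h4 : edist (incl j i x) (incl j i y) = D + D := by rw [← hD, ENNReal.add_halves]
    rw [h4] at h3
    refine ⟨incl j i z, exists_between_of_midpoint hfin hpq h ?_ ?_⟩
    · rw [hD]
      exact le_antisymm h1 ((ENNReal.add_le_add_iff_right hf).1 (h3.trans (by gcongr)))
    · rw [hD]
      exact le_antisymm h2 ((ENNReal.add_le_add_iff_left hf).1 (h3.trans (by gcongr)))
  obtain ⟨i, x, rfl⟩ := exists_incl j u
  obtain ⟨k, y, rfl⟩ := exists_incl j v
  rcases exists_edist_incl ho hj x y with ⟨rfl, h⟩ | ⟨a, b, h⟩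
  · exact ⟨_, _, huv, by simp, i, x, y, rfl, rfl, h.symm⟩
  · rw [h] at hfin
    have l1 := edist_incl_le j x (j i a)
    have l2 := edist_incl_glued ho i k a b
    have l3 := edist_incl_le j (j k b) y
    have tri := edist_triangle4 (incl j i x) (incl j i (j i a)) (incl j k (j k b)) (incl j k y)
    have f3 : edist (j k b) y ≠ ⊤ := (ENNReal.add_ne_top.1 hfin).2
    have f2 : edist (j o a) (j o b) ≠ ⊤ := (ENNReal.add_ne_top.1 (ENNReal.add_ne_top.1 hfin).1).2
    have e1 : edist (incl j i x) (incl j i (j i a)) = edist x (j i a) := by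
      refine le_antisymm l1 ?_
      rw [h, l2, add_assoc, add_assoc] at tri
      refine (ENNReal.add_le_add_iff_right (ENNReal.add_ne_top.2 ⟨f2, f3⟩)).1 (tri.trans ?_)
      gcongr
    have e3 : edist (incl j k (j k b)) (incl j k y) = edist (j k b) y := by
      refine le_antisymm l3 ?_
      rw [h, l2, e1] at tri
      exact (ENNReal.add_le_add_iff_left (ENNReal.add_ne_top.1 hfin).1).1 tri
    rw [← e1, ← e3, ← l2] at h
    by_cases c1 : incl j i x = incl j i (j i a)
    · by_cases c2 : incl j i (j i a) = incl j k (j k b)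
      · refine ⟨incl j k (j k b), incl j k y, ?_, ?_, k, _, _, rfl, rfl, e3.symm⟩
        · rw [← c2, ← c1]; exact huv
        · rw [h, c1, c2]; simp
      · refine ⟨_, _, c2, h, o, j o a, j o b, incl_glued j o i a, incl_glued j o k b, l2.symm⟩
    · refine ⟨_, _, c1, ?_, i, _, _, rfl, rfl, e1.symm⟩
      refine le_antisymm ?_ ?_
      · rw [edist_self, zero_add]; exact edist_triangle _ _ _
      · rw [h, edist_self, zero_add, add_assoc]
        gcongr
        exact edist_triangle _ _ _

theorem completeSpace
    (ho : ∀ i a b, edist (j o a) (j o b) ≤ edist (j i a) (j i b))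
    (hj : ∀ i, Continuous (j i)) [∀ i, CompactSpace (X i)] : CompleteSpace (Glue j) := by
  refine EMetric.complete_of_cauchySeq_tendsto fun w hw => ?_
  by_cases hA : ∀ N : ℕ, ∀ ε : ℝ≥0∞, 0 < ε → ∃ m ≥ N, ∃ a, edist (w m) (incl j o (j o a)) < ε
  · have hpos : ∀ n : ℕ, (0 : ℝ≥0∞) < (n : ℝ≥0∞)⁻¹ := fun n =>
      ENNReal.inv_pos.2 (ENNReal.natCast_ne_top n)
    choose φ hφ a ha using fun n : ℕ => hA n _ (hpos n)
    have hK : IsCompact (Set.range fun a => incl j o (j o a)) :=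
      isCompact_range ((continuous_incl j o).comp (hj o))
    obtain ⟨z, -, σ, hσ, hz⟩ := hK.isSeqCompact fun n => Set.mem_range_self (a n)
    refine ⟨z, tendsto_nhds_of_cauchySeq_of_subseq hw (f := φ ∘ σ) (p := atTop) ?_ ?_⟩
    · exact (tendsto_atTop_mono hφ tendsto_id).comp hσ.tendsto_atTop
    · rw [tendsto_iff_edist_tendsto_0] at hz ⊢
      have h1 : Tendsto (fun n : ℕ => ((σ n : ℕ) : ℝ≥0∞)⁻¹) atTop (𝓝 0) :=
        ENNReal.tendsto_inv_nat_nhds_zero.comp hσ.tendsto_atTop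
      have h2 := h1.add hz
      rw [add_zero] at h2
      refine tendsto_of_tendsto_of_tendsto_of_le_of_le tendsto_const_nhds h2
        (fun _ => zero_le) fun n => ?_
      exact (edist_triangle _ _ _).trans (add_le_add_left (ha (σ n)).le _)
  · push Not at hA
    obtain ⟨N, ε, hε, hN⟩ := hA
    obtain ⟨N', hN'⟩ := EMetric.cauchySeq_iff.1 hw ε hε
    obtain ⟨i, x, hx⟩ := exists_incl j (w (max N N'))
    have hmem : ∀ n, w (n + max N N') ∈ Set.range (incl j i) := fun n => by
      obtain ⟨k, y, hy⟩ := exists_incl j (w (n + max N N'))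
      have hlt := hN' (max N N') (le_max_right _ _) (n + max N N') (by omega)
      rw [← hx, ← hy] at hlt
      rcases exists_edist_incl ho hj x y with ⟨rfl, -⟩ | ⟨a, b, h⟩
      · exact ⟨y, hy⟩
      · have h1 := hN (max N N') (le_max_left _ _) a
        rw [← hx, ← incl_glued j i o] at h1
        refine absurd hlt (not_lt.2 (h1.trans ((edist_incl_le j _ _).trans ?_)))
        rw [h, add_assoc]
        exact le_self_add
    have hK : IsComplete (Set.range (incl j i)) :=
      (isCompact_range (continuous_incl j i)).isComplete
    obtain ⟨z, -, hz⟩ := cauchySeq_tendsto_of_isComplete hK hmem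
      (hw.comp_tendsto (tendsto_add_atTop_nat _))
    exact ⟨z, (tendsto_add_atTop_iff_nat _).1 hz⟩

end Glue

end GlueComplete

theorem NonExp.continuous_eval {S : Type*} {Z : Type*} [EMetricSpace S] [EMetricSpace Z] :
    Continuous fun q : NonExp S Z × S => q.1 q.2 := by
  have : LipschitzWith 2 fun q : NonExp S Z × S => q.1 q.2 := by
    intro q q'
    calc edist (q.1 q.2) (q'.1 q'.2) ≤ edist (q.1 q.2) (q'.1 q.2) +
          edist (q'.1 q.2) (q'.1 q'.2) := edist_triangle _ _ _
      _ ≤ edist q q' + edist q q' := add_le_add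
          ((le_iSup (fun x => edist (q.1 x) (q'.1 x)) q.2).trans (le_max_left _ _))
          ((q'.1.edist_le _ _).trans (le_max_right _ _))
      _ = (2 : ℝ≥0) * edist q q' := by rw [← two_mul]; rfl
  exact this.continuous

section GluedPieces

/-- The closed geodesic and the point of a gluing piece. -/
def gluingMap (i : ℝ≥0) : UnitAddCircle ⊕ Unit → (gluingPiece i).M :=
  Sum.elim (gluingPiece i).γ (fun _ => (gluingPiece i).p)

theorem continuous_gluingMap (i : ℝ≥0) : Continuous (gluingMap i) :=
  (gluingPiece i).isometry.continuous.sumElim continuous_const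

theorem GluingPiece.edist_p_γ {i : ℝ≥0} (P : GluingPiece i) (hi : 0 < i) (t : UnitAddCircle) :
    edist P.p (P.γ t) = (3 / 8 + i : ℝ≥0) := by
  obtain ⟨c, ⟨hc, h0, h1⟩, -⟩ := P.existsUnique_geodesic hi t
  rw [← h0, ← h1, hc, Subtype.edist_eq, edist_dist, Real.dist_eq, zero_sub, abs_neg,
    abs_of_nonneg (NNReal.coe_nonneg _), ENNReal.ofReal_coe_nnreal]

theorem edist_gluingMap_zero_le (i : ℝ≥0) (a b : UnitAddCircle ⊕ Unit) :
    edist (gluingMap 0 a) (gluingMap 0 b) ≤ edist (gluingMap i a) (gluingMap i b) := by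
  have key : ∀ t, edist (gluingPiece 0).p ((gluingPiece 0).γ t) ≤
      edist (gluingPiece i).p ((gluingPiece i).γ t) := fun t => by
    rcases eq_zero_or_pos i with rfl | hi
    · exact le_rfl
    · rw [(gluingPiece i).edist_p_γ hi]
      refine ((gluingPiece 0).edist_lt rfl t).le.trans ?_
      exact_mod_cast le_self_add
  rcases a with s | _ <;> rcases b with t | _
  · simp only [gluingMap, Sum.elim_inl, (gluingPiece _).isometry.edist_eq, le_refl]
  · simpa only [gluingMap, Sum.elim_inl, Sum.elim_inr, edist_comm _ (gluingPiece _).p] using key s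
  · exact key t
  · simp [gluingMap]

/-- The space obtained by gluing all the pieces along their closed geodesics and points. -/
abbrev GluedPieces : Type := Glue gluingMap

namespace GluedPieces

theorem isConvexMetric : IsConvexMetric GluedPieces :=
  Glue.isConvexMetric (o := (0 : ℝ≥0)) edist_gluingMap_zero_le continuous_gluingMap
    fun i => (gluingPiece i).midpoint

instance : CompleteSpace GluedPieces :=
  have : ∀ i, CompactSpace (gluingPiece i).M := fun i => (gluingPiece i).M.compact
  Glue.completeSpace (o := (0 : ℝ≥0)) edist_gluingMap_zero_le continuous_gluingMap

/-- The common closed geodesic of the pieces. -/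
def circle : NonExp UnitAddCircle GluedPieces where
  toFun t := Glue.incl gluingMap 0 ((gluingPiece 0).γ t)
  lipschitz := LipschitzWith.of_edist_le fun s t =>
    (Glue.edist_incl_le gluingMap _ _).trans ((gluingPiece 0).isometry s t).le

/-- The constant map at the common point of the pieces. -/
def point : NonExp UnitAddCircle GluedPieces where
  toFun _ := Glue.incl gluingMap 0 (gluingPiece 0).p
  lipschitz := LipschitzWith.const' _

theorem circle_apply (i : ℝ≥0) (t : UnitAddCircle) :
    circle t = Glue.incl gluingMap i ((gluingPiece i).γ t) :=
  Glue.incl_glued gluingMap 0 i (Sum.inl t)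

theorem point_apply (i : ℝ≥0) (t : UnitAddCircle) :
    point t = Glue.incl gluingMap i (gluingPiece i).p :=
  Glue.incl_glued gluingMap 0 i (Sum.inr ())

theorem isometry_circle : Isometry circle := fun s t =>
  (Glue.edist_incl_glued (o := (0 : ℝ≥0)) edist_gluingMap_zero_le 0 0
    (Sum.inl s) (Sum.inl t)).trans ((gluingPiece 0).isometry s t)

theorem exists_lipschitz_toComplex : ∃ Ψ : GluedPieces → ℂ, LipschitzWith 16 Ψ ∧
    ∀ i x, Ψ (Glue.incl gluingMap i x) = (gluingPiece i).ψ x := by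
  refine Glue.exists_lipschitz_extension (o := (0 : ℝ≥0)) edist_gluingMap_zero_le
    continuous_gluingMap (fun i => (gluingPiece i).ψ) (fun i => (gluingPiece i).lipschitz) ?_
  rintro i k (t | _)
  · exact ((gluingPiece i).ψ_γ t).trans ((gluingPiece k).ψ_γ t).symm
  · exact (gluingPiece i).ψ_p.trans (gluingPiece k).ψ_p.symm

theorem ψ_ne_zero {i : ℝ≥0} (x : (gluingPiece i).M) (t : UnitAddCircle)
    (h : edist (circle t) (Glue.incl gluingMap i x) +
      edist (Glue.incl gluingMap i x) (point t) ≤ (3 / 8 : ℝ≥0)) :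
    (gluingPiece i).ψ x ≠ 0 := by
  rcases eq_zero_or_pos i with rfl | hi
  · exact (gluingPiece 0).ψ_ne_zero_of_eq rfl x
  obtain ⟨b, hb⟩ := Glue.exists_edist_glued_incl (o := (0 : ℝ≥0)) edist_gluingMap_zero_le
    continuous_gluingMap 0 (Sum.inl t) x
  obtain ⟨b', hb'⟩ := Glue.exists_edist_glued_incl (o := (0 : ℝ≥0)) edist_gluingMap_zero_le
    continuous_gluingMap 0 (Sum.inr ()) x
  change edist (circle t) _ = _ at hb
  change edist (point t) _ = _ at hb'
  rw [edist_comm _ (point t), hb, hb'] at h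
  have hq : ∀ s, 1 / 4 ≤ edist (gluingPiece 0).p ((gluingPiece 0).γ s) :=
    (gluingPiece 0).le_edist rfl
  have h14 : (1 / 4 : ℝ≥0∞) = ((1 / 4 : ℝ≥0) : ℝ≥0∞) := by
    rw [ENNReal.coe_div (by norm_num)]; rfl
  have h16 : (1 / 16 : ℝ≥0∞) = ((1 / 16 : ℝ≥0) : ℝ≥0∞) := by
    rw [ENNReal.coe_div (by norm_num)]; rfl
  have hsum : ∀ d d' : ℝ≥0∞, d + d' + 1 / 4 ≤ (3 / 8 : ℝ≥0) → d ≤ 1 / 16 ∨ d' ≤ 1 / 16 := by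
    intro d d' hd
    by_contra! hcon
    rw [h16] at hcon
    refine absurd hd (not_le.2 (lt_of_lt_of_le (b := d + d' + (1 / 4 : ℝ≥0)) ?_ (by rw [h14])))
    refine lt_of_le_of_lt (b := ((1 / 16 + 1 / 16 + 1 / 4 : ℝ≥0) : ℝ≥0∞)) ?_ ?_
    · exact_mod_cast (by rw [← NNReal.coe_le_coe]; norm_num)
    · push_cast
      exact ENNReal.add_lt_add_right (by simp) (ENNReal.add_lt_add hcon.1 hcon.2)
  rcases b with s | _ <;> rcases b' with s' | _
  · have h' : edist x ((gluingPiece i).γ s) + edist x ((gluingPiece i).γ s') + 1 / 4 ≤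
        (3 / 8 : ℝ≥0) := by
      refine le_trans ?_ h
      rw [edist_comm x, edist_comm x, add_comm (edist (gluingMap 0 (Sum.inr ())) _), ← add_assoc]
      refine add_le_add (add_le_add le_add_self le_rfl) (hq s')
    rcases hsum _ _ h' with h' | h'
    · exact (gluingPiece i).ψ_ne_zero_of_near_γ x s h'
    · exact (gluingPiece i).ψ_ne_zero_of_near_γ x s' h'
  · exfalso
    have h1 : edist (gluingPiece i).p ((gluingPiece i).γ s) ≤ (3 / 8 : ℝ≥0) := by
      refine le_trans ?_ h
      rw [edist_comm]
      exact (edist_triangle _ x _).trans (add_le_add le_add_self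
        (by rw [edist_comm x]; exact le_add_self))
    rw [(gluingPiece i).edist_p_γ hi, ENNReal.coe_le_coe] at h1
    exact absurd h1 (not_le.2 (lt_add_of_pos_right _ hi))
  · exfalso
    have h1 : (1 / 4 : ℝ≥0∞) + 1 / 4 ≤ (3 / 8 : ℝ≥0) := by
      refine le_trans (add_le_add ?_ ?_) h
      · refine (hq t).trans ?_
        rw [edist_comm]; exact le_self_add
      · exact (hq s').trans le_self_add
    rw [h14, ← ENNReal.coe_add, ENNReal.coe_le_coe, ← NNReal.coe_le_coe] at h1
    norm_num at h1
  · have h' : edist x (gluingPiece i).p + edist x (gluingPiece i).p + 1 / 4 ≤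
        (3 / 8 : ℝ≥0) := by
      refine le_trans ?_ h
      rw [edist_comm x, add_comm _ (1 / 4), ← add_assoc]
      refine add_le_add (add_le_add ?_ le_rfl) le_add_self
      refine (hq t).trans ?_
      rw [edist_comm]; exact le_rfl
    rcases hsum _ _ h' with h' | h' <;> exact (gluingPiece i).ψ_ne_zero_of_near_p x h'

theorem not_le_of_mem_curveLengths {l : ℝ≥0∞} (hl : l ∈ curveLengths circle point) :
    ¬ l ≤ (3 / 8 : ℝ≥0) := by
  rintro hle
  obtain ⟨a, b, φ, hab, hφ, ha, hb, rfl⟩ := hl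
  obtain ⟨Ψ, hΨ, hΨi⟩ := exists_lipschitz_toComplex
  refine not_exists_homotopy_unitCircleMap hab (fun q => Ψ (φ q.1 q.2)) ?_ ?_ ?_ 1 ?_
  · have h1 : Continuous fun q : Set.Icc a b × UnitAddCircle => φ q.1 :=
      (continuousOn_iff_continuous_domRestrict.1 hφ).comp continuous_fst
    exact hΨ.continuous.comp (NonExp.continuous_eval.comp (h1.prodMk continuous_snd))
  · rintro ⟨⟨s, hs⟩, t⟩
    dsimp only
    obtain ⟨i, x, hx⟩ := Glue.exists_incl gluingMap (φ s t)
    rw [← hx, hΨi]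
    refine ψ_ne_zero x t (le_trans ?_ hle)
    rw [hx]
    have h1 := eVariationOn.edist_le φ (s := Set.Icc a b ∩ Set.Icc a s) (x := a) (y := s)
      ⟨⟨le_rfl, hab⟩, ⟨le_rfl, hs.1⟩⟩ ⟨hs, ⟨hs.1, le_rfl⟩⟩
    have h2 := eVariationOn.edist_le φ (s := Set.Icc a b ∩ Set.Icc s b) (x := s) (y := b)
      ⟨hs, ⟨le_rfl, hs.2⟩⟩ ⟨⟨hab, le_rfl⟩, ⟨hs.2, le_rfl⟩⟩
    rw [ha] at h1
    rw [hb] at h2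
    have h3 : eVariationOn φ (Set.Icc a b ∩ Set.Icc a s) +
        eVariationOn φ (Set.Icc a b ∩ Set.Icc s b) ≤ eVariationOn φ (Set.Icc a b) := by
      refine (eVariationOn.add_le_union φ ?_).trans (eVariationOn.mono φ ?_)
      · rintro u ⟨-, hu⟩ v ⟨-, hv⟩
        exact hu.2.trans hv.1
      · exact Set.union_subset Set.inter_subset_left Set.inter_subset_left
    refine (add_le_add ?_ ?_).trans h3
    · exact (le_iSup (fun t => edist (circle t) (φ s t)) t).trans h1
    · exact (le_iSup (fun t => edist (φ s t) (point t)) t).trans h2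
  · intro t
    simp only [ha]
    rw [circle_apply 0, hΨi]
    exact (gluingPiece 0).ψ_γ t
  · intro t
    simp only [hb]
    rw [point_apply 0, hΨi]
    exact (gluingPiece 0).ψ_p

theorem exists_lipschitz_path {ε : ℝ≥0} (hε : 0 < ε) :
    ∃ φ : ℝ → NonExp UnitAddCircle GluedPieces, LipschitzWith (3 / 8 + ε) φ ∧
      φ 0 = circle ∧ φ 1 = point := by
  obtain ⟨h, h0, h1, hs, ht⟩ := (gluingPiece ε).homotopy hε
  let c : ℝ → ℝ := fun s => Set.projIcc (0 : ℝ) 1 zero_le_one s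
  have hc : ∀ s, c s ∈ Set.Icc (0 : ℝ) 1 := fun s => Subtype.property _
  have hc0 : c 0 = 0 := congrArg Subtype.val (Set.projIcc_left zero_le_one)
  have hc1 : c 1 = 1 := congrArg Subtype.val (Set.projIcc_right zero_le_one)
  refine ⟨fun s => ⟨fun t => Glue.incl gluingMap ε (h (c s) t),
    LipschitzWith.of_edist_le fun t t' =>
      (Glue.edist_incl_le gluingMap _ _).trans (ht _ (hc s) t t')⟩, ?_, ?_, ?_⟩
  · intro s s'
    refine iSup_le fun t => (Glue.edist_incl_le gluingMap _ _).trans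
      ((hs _ (hc s) _ (hc s') t).trans ?_)
    have h2 : |c s - c s'| ≤ |s - s'| := by
      have := (LipschitzWith.projIcc (zero_le_one' ℝ)).dist_le_mul s s'
      simpa [Subtype.dist_eq, Real.dist_eq] using this
    rw [mul_comm, ENNReal.ofReal_mul (by positivity), edist_dist, Real.dist_eq]
    refine mul_le_mul' (le_of_eq ?_) (ENNReal.ofReal_le_ofReal h2)
    rw [← ENNReal.ofReal_coe_nnreal]
    push_cast
    rfl
  · apply DFunLike.ext
    intro t
    change Glue.incl gluingMap ε (h (c 0) t) = _
    rw [hc0, h0, circle_apply ε]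
  · apply DFunLike.ext
    intro t
    change Glue.incl gluingMap ε (h (c 1) t) = _
    rw [hc1, h1, point_apply ε]

theorem lengthEDist_circle_point : lengthEDist circle point = (3 / 8 : ℝ≥0) := by
  apply le_antisymm
  · refine ENNReal.le_of_forall_pos_le_add fun ε hε _ => ?_
    obtain ⟨φ, hφ, h0, h1⟩ := exists_lipschitz_path hε
    have hmem : eVariationOn φ (Set.Icc 0 1) ∈ curveLengths circle point :=
      ⟨0, 1, φ, zero_le_one, hφ.continuous.continuousOn, h0, h1, rfl⟩
    refine (sInf_le hmem).trans ?_
    have h2 := (hφ.lipschitzOnWith (s := Set.univ)).comp_eVariationOn_le (g := id)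
      (s := Set.Icc (0 : ℝ) 1) (Set.mapsTo_univ _ _)
    have h3 : eVariationOn (id : ℝ → ℝ) (Set.Icc 0 1) ≤ 1 := by simp
    refine h2.trans ?_
    rw [← ENNReal.coe_add]
    exact (mul_le_mul_right h3 _).trans (mul_one _).le
  · exact le_sInf fun l hl => (not_le.1 (not_le_of_mem_curveLengths hl)).le

end GluedPieces

end GluedPieces

section InternalHom

theorem isConvexMetric_Icc (a b : ℝ) : IsConvexMetric (Set.Icc a b) := by
  rintro ⟨x, hx⟩ ⟨y, hy⟩ hne hfin
  have key : ∀ u v : ℝ, |v - u| = |x - y| / 2 → edist u v = edist x y / 2 := fun u v h => by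
    rw [edist_dist, edist_dist, Real.dist_eq, Real.dist_eq, abs_sub_comm, h,
      ENNReal.ofReal_div_of_pos two_pos]
    simp
  refine ⟨⟨(x + y) / 2, by constructor <;> linarith [hx.1, hx.2, hy.1, hy.2]⟩,
    exists_between_of_midpoint hfin hne (by simp) (key _ _ ?_) (key _ _ ?_)⟩
  · rw [show (x + y) / 2 - x = (y - x) / 2 by ring, abs_div, abs_two, abs_sub_comm]
  · rw [show y - (x + y) / 2 = (y - x) / 2 by ring, abs_div, abs_two, abs_sub_comm]

namespace CCMet

/-- The interval `[0, l]`. -/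
def interval (l : ℝ) : CCMet.{0} where
  carrier := Set.Icc (0 : ℝ) l
  convex := isConvexMetric_Icc 0 l

/-- The morphism from the unit with value `x`. -/
def const {X : CCMet.{u}} (x : X) : unit ⟶ X :=
  mkHom (X := unit) (fun _ => x) fun _ _ => by rw [edist_self]; exact zero_le

section Representable

variable {X Y H : CCMet.{u}} (R : ((tensorRight X).op ⋙ yoneda.obj Y).RepresentableBy H)

/-- The non-expansive map represented by a point of an internal hom. -/
def eval (h : H) : NonExp X Y where
  toFun x := NonExp.toFun (R.homEquiv (const h)) (WithLp.toLp 1 (PUnit.unit, x))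
  lipschitz := LipschitzWith.of_edist_le fun x x' => by
    refine (NonExp.edist_le (R.homEquiv (const h)) _ _).trans ?_
    refine (edist_l1 (X := PUnit.{u + 1}) _ _).le.trans ?_
    exact (add_le_add (edist_self _).le le_rfl).trans (zero_add _).le

theorem eval_injective : Function.Injective (eval R) := by
  intro h h' e
  have e1 : R.homEquiv (const h) = R.homEquiv (const h') :=
    hom_ext fun w => congrArg (fun f : NonExp X Y => f.toFun w.snd) e
  exact congrArg (fun f : NonExp (unit : CCMet.{u}) H => f.toFun PUnit.unit)
    (R.homEquiv.injective e1)

theorem eval_hom {Z : CCMet.{u}} (φ : Z ⟶ H) (z : Z) (x : X) :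
    eval R (φ.toFun z) x = NonExp.toFun (R.homEquiv φ) (WithLp.toLp 1 (z, x)) := by
  have e : const (φ.toFun z) = const z ≫ φ := rfl
  change NonExp.toFun (R.homEquiv (const (φ.toFun z))) _ = _
  rw [e, R.homEquiv_comp]
  rfl

end Representable

/-- If the internal hom exists, then the infimum of the lengths of Lipschitz paths is attained. -/
theorem InternalHomExists.exists_mem_curveLengths {X Y : CCMet.{0}}
    (hXY : InternalHomExists X Y) (f g : NonExp X Y) (l : ℝ≥0)
    (hfg : ∀ ε : ℝ≥0, 0 < ε → ∃ φ : ℝ → NonExp X Y, LipschitzWith (l + ε) φ ∧ φ 0 = f ∧ φ 1 = g) :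
    ∃ l' ∈ curveLengths f g, l' ≤ l := by
  obtain ⟨H, ⟨R⟩⟩ := hXY.has_representation
  have hpath : ∀ ε : ℝ≥0, 0 < ε → ∃ h h' : H, eval R h = f ∧ eval R h' = g ∧
      edist h h' ≤ l + ε := by
    intro ε hε
    obtain ⟨φ, hφ, h0, h1⟩ := hfg ε hε
    have hpos : 0 < l + ε := add_pos_of_nonneg_of_pos zero_le hε
    have hpos' : (0 : ℝ) < (l + ε : ℝ≥0) := hpos
    let F : tensor (interval (l + ε : ℝ≥0)) X ⟶ Y :=
      mkHom (X := tensor (interval (l + ε : ℝ≥0)) X)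
        (fun w : WithLp 1 (Set.Icc (0 : ℝ) (l + ε : ℝ≥0) × X) =>
          φ ((w.fst : ℝ) / (l + ε : ℝ≥0)) w.snd) (by
      intro (w : WithLp 1 (Set.Icc (0 : ℝ) (l + ε : ℝ≥0) × X))
        (w' : WithLp 1 (Set.Icc (0 : ℝ) (l + ε : ℝ≥0) × X))
      refine le_trans ?_ (edist_l1 (X := Set.Icc (0 : ℝ) (l + ε : ℝ≥0)) _ _).ge
      refine (edist_triangle _ (φ ((w'.fst : ℝ) / (l + ε : ℝ≥0)) w.snd) _).trans
        (add_le_add ?_ (NonExp.edist_le _ _ _))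
      refine (le_iSup (fun x => edist (φ ((w.fst : ℝ) / (l + ε : ℝ≥0)) x)
        (φ ((w'.fst : ℝ) / (l + ε : ℝ≥0)) x)) w.snd).trans ((hφ _ _).trans ?_)
      rw [Subtype.edist_eq, edist_dist, edist_dist, ← ENNReal.ofReal_coe_nnreal,
        ← ENNReal.ofReal_mul hpos'.le, Real.dist_eq, Real.dist_eq, ← sub_div, abs_div,
        abs_of_pos hpos', mul_div_cancel₀ _ hpos'.ne'])
    have hF : R.homEquiv (R.homEquiv.symm F) = F := R.homEquiv.apply_symm_apply F
    let P := R.homEquiv.symm F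
    refine ⟨P.toFun (⟨0, le_rfl, hpos'.le⟩ : Set.Icc (0 : ℝ) (l + ε : ℝ≥0)),
      P.toFun (⟨_, hpos'.le, le_rfl⟩ : Set.Icc (0 : ℝ) (l + ε : ℝ≥0)), ?_, ?_, ?_⟩
    · apply DFunLike.ext
      intro x
      rw [eval_hom, hF, ← h0]
      change φ (0 / _) x = φ 0 x
      rw [zero_div]
    · apply DFunLike.ext
      intro x
      rw [eval_hom, hF, ← h1]
      change φ ((l + ε : ℝ≥0) / (l + ε : ℝ≥0)) x = φ 1 x
      rw [div_self hpos'.ne']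
    · refine (NonExp.edist_le P _ _).trans ?_
      change edist (0 : ℝ) ((l + ε : ℝ≥0) : ℝ) ≤ _
      rw [edist_dist, Real.dist_eq, zero_sub, abs_neg, abs_of_pos hpos',
        ENNReal.ofReal_coe_nnreal, ENNReal.coe_add]
  obtain ⟨h, h', rfl, rfl, -⟩ := hpath 1 one_pos
  have hle : edist h h' ≤ l := by
    refine ENNReal.le_of_forall_pos_le_add fun ε hε _ => ?_
    obtain ⟨k, k', hk, hk', hkk⟩ := hpath ε hε
    rwa [eval_injective R hk, eval_injective R hk'] at hkk
  have hfin : edist h h' ≠ ⊤ := ne_top_of_le_ne_top ENNReal.coe_ne_top hle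
  obtain ⟨d, hd0, hd, c, hc, hc0, hc1⟩ : ∃ (d : ℝ) (hd : 0 ≤ d) (_ : ENNReal.ofReal d = edist h h')
      (c : Set.Icc (0 : ℝ) d → H), Isometry c ∧ c ⟨0, le_rfl, hd⟩ = h ∧ c ⟨d, hd, le_rfl⟩ = h' :=
    ⟨_, ENNReal.toReal_nonneg, ENNReal.ofReal_toReal hfin, H.convex.exists_geodesic h h' hfin⟩
  let C : interval d ⟶ H := mkHom (X := interval d) c fun x y => (hc x y).le
  let φ : ℝ → NonExp X Y := fun s => eval R (c (Set.projIcc 0 d hd0 s))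
  have hφ : LipschitzWith 1 φ := LipschitzWith.of_edist_le fun s s' => by
    refine iSup_le fun x => ?_
    have e : ∀ s, φ s x =
        NonExp.toFun (R.homEquiv C) (WithLp.toLp 1 (Set.projIcc 0 d hd0 s, x)) :=
      fun s => eval_hom R C _ x
    rw [e, e]
    refine (NonExp.edist_le (R.homEquiv C) _ _).trans ?_
    refine (edist_l1 (X := Set.Icc (0 : ℝ) d) _ _).le.trans ?_
    have := LipschitzWith.projIcc hd0 s s'
    rw [ENNReal.coe_one, one_mul] at this
    exact (add_le_add this (edist_self x).le).trans (add_zero _).le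
  refine ⟨_, ⟨0, d, φ, hd0, hφ.continuous.continuousOn, ?_, ?_, rfl⟩, ?_⟩
  · simp only [φ, Set.projIcc_left, hc0]
  · simp only [φ, Set.projIcc_right, hc1]
  · have h2 := (hφ.lipschitzOnWith (s := Set.univ)).comp_eVariationOn_le (g := id)
      (s := Set.Icc (0 : ℝ) d) (Set.mapsTo_univ _ _)
    have h3 : eVariationOn (id : ℝ → ℝ) (Set.Icc 0 d) ≤ ENNReal.ofReal d := by simp
    rw [ENNReal.coe_one, one_mul] at h2
    exact h2.trans (h3.trans (hd.le.trans hle))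

/-- In a monoidal closed structure all internal homs exist. -/
theorem internalHomExists_of_monoidalClosed (h : MonoidalClosed CCMet.{u}) (X Y : CCMet.{u}) :
    InternalHomExists X Y := by
  let adj := (h.closed X).adj.ofNatIsoLeft (BraidedCategory.tensorLeftIsoTensorRight X)
  exact (adj.representableBy Y).isRepresentable

end CCMet

end InternalHom

section Example

/-- The closed geodesic of the piece `0` is not contractible. -/
theorem not_nullhomotopic_γ_zero :
    ¬ (⟨(gluingPiece 0).γ, (gluingPiece 0).isometry.continuous⟩ :
      C(UnitAddCircle, (gluingPiece 0).M)).Nullhomotopic := by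
  rintro ⟨y, ⟨F⟩⟩
  refine not_exists_homotopy_unitCircleMap (zero_le_one' ℝ) (fun q => (gluingPiece 0).ψ (F q))
    ((gluingPiece 0).lipschitz.continuous.comp F.continuous)
    (fun q => (gluingPiece 0).ψ_ne_zero_of_eq rfl _) (fun t => ?_) ((gluingPiece 0).ψ y)
    (fun t => ?_)
  · exact (congrArg _ (F.apply_zero t)).trans ((gluingPiece 0).ψ_γ t)
  · exact congrArg _ (F.apply_one t)

theorem not_internalHomExists_circleOne :
    ¬ CCMet.InternalHomExists circleOne ⟨GluedPieces, GluedPieces.isConvexMetric⟩ := fun h => by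
  obtain ⟨l, hl, hle⟩ := h.exists_mem_curveLengths GluedPieces.circle GluedPieces.point (3 / 8)
    fun _ => GluedPieces.exists_lipschitz_path
  exact GluedPieces.not_le_of_mem_curveLengths hl hle

end Example

end

theorem mainTheorem7 :
    (∃ (M : ℝ≥0 → ClosedRiemannianManifold) (γ : ∀ i, UnitAddCircle → M i) (p : ∀ i, M i)
        (L : ℝ≥0) (hγ : ∀ i, Isometry (γ i)),
      -- the closed geodesic and the point in `M 0`
      (¬ (⟨γ 0, (hγ 0).continuous⟩ : C(UnitAddCircle, M 0)).Nullhomotopic) ∧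
      p 0 ∉ Set.range (γ 0) ∧
      (∀ t, edist (p 0) (γ 0 t) < L) ∧
      -- the closed geodesic and the point in `M ε` for `ε > 0`
      (∀ ε, 0 < ε → ∀ t, ∃! c : Set.Icc (0 : ℝ) (L + ε : ℝ≥0) → M ε,
        IsMinimizingGeodesic (p ε) (γ ε t) c) ∧
      -- the gluing of all the `M i` along the closed geodesics and the points
      ∃ (j : ∀ i, UnitAddCircle ⊕ Unit → M i)
        (_ : ∀ i, j i = Sum.elim (γ i) (fun _ => p i))
        (_ : CompleteSpace (Glue j)) (hconv : IsConvexMetric (Glue j))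
        (f g : NonExp UnitAddCircle (Glue j)),
        (∀ i t, f t = Glue.incl j i (γ i t)) ∧
        (∀ i t, g t = Glue.incl j i (p i)) ∧
        Isometry f ∧
        lengthEDist f g = L ∧
        (L : ℝ≥0∞) ∉ curveLengths f g ∧
        ¬ CCMet.InternalHomExists circleOne ⟨Glue j, hconv⟩) ∧
    IsEmpty (MonoidalClosed CCMet.{0}) := by
  refine ⟨⟨fun i => (gluingPiece i).M, fun i => (gluingPiece i).γ, fun i => (gluingPiece i).p,
    3 / 8, fun i => (gluingPiece i).isometry, not_nullhomotopic_γ_zero, ?_,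
    (gluingPiece 0).edist_lt rfl, fun ε hε => (gluingPiece ε).existsUnique_geodesic hε,
    gluingMap, fun _ => rfl, inferInstanceAs (CompleteSpace GluedPieces),
    GluedPieces.isConvexMetric, GluedPieces.circle, GluedPieces.point,
    GluedPieces.circle_apply, GluedPieces.point_apply, GluedPieces.isometry_circle,
    GluedPieces.lengthEDist_circle_point,
    fun h => GluedPieces.not_le_of_mem_curveLengths h le_rfl,
    not_internalHomExists_circleOne⟩,
    ⟨fun h => not_internalHomExists_circleOne (CCMet.internalHomExists_of_monoidalClosed h _ _)⟩⟩
  rintro ⟨t, ht : (gluingPiece 0).γ t = (gluingPiece 0).p⟩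
  have := (gluingPiece 0).le_edist rfl t
  rw [ht, edist_self] at this
  simp at this
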